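/- **Normalization for first-order $\mathsf{LC}$.** *Formulas and proof terms.* Fix a first-order language; formulas are built from atomic formulas (including $\bot$) by $\land,\lor,\to,\forall,\exists$. The system $\mathsf{LC}$ is the Church-style $\lambda$-calculus of natural deduction for intuitionistic first-order logic with Dummett's rule. Its proof terms, taken up to renaming of bound variables, are $$x^A \mid \langle u,t\rangle \mid u\,\pi_i \mid \lambda x^A u \mid t\,u \mid \iota_i(u) \mid u\,[x^A.w_1,y^B.w_2] \mid \lambda\alpha\,u \mid u\,m \mid (m,u) \mid u\,[(\alpha,x^A).t] \mid u\parallel_a v \mid \mathsf{efq}_P(u)$$ ($i\in\{0,1\}$, $m$ an individual term, $P$ atomic). They are typed by the usual introduction and elimination rules ($x^A:A$; $\mathsf{efq}_P(u):P$ if $u:\bot$) and by the rule: if $u:C$ with $a:A\to B$, and $v:C$ with $a:B\to A$, then $u\parallel_a v:C$, where $a$ is bound in $u$ and $v$. The system $\mathsf{LC}^\star$ adds constants $\mathcal A^{A\to B}:A\to B$ for all formulas $A,B$. *Basic reductions.* A stack $\sigma=\sigma_1\cdots\sigma_n$ is a finite, possibly empty sequence of entries, each a proof term, an individual term, $\pi_i$,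 $[x.u,y.v]$ or $[(\alpha,x).v]$; $t\,\sigma$ is $(\cdots(t\,\sigma_1)\cdots)\sigma_n$. A parallel context $\mathcal C[\ ]$ is given by $\mathcal C::=[\ ]\mid \mathcal C\parallel_b u\mid u\parallel_b\mathcal C$; filling its hole may bind variables. The basic reductions are - $(\lambda x\,u)t\mapsto u[t/x]$; $(\lambda\alpha\,u)m\mapsto u[m/\alpha]$; $\langle u_0,u_1\rangle\pi_i\mapsto u_i$; $\iota_i(u)[x_0.t_0,x_1.t_1]\mapsto t_i[u/x_i]$; $(m,u)[(\alpha,x).v]\mapsto v[m/\alpha][u/x]$; - $(u\parallel_a v)\,\xi\mapsto u\,\xi\parallel_a v\,\xi$ for a stack entry $\xi$ in which $a$ is not free; - if $a$ has types $A\to B$ in the left and $B\to A$ in the right component of $\parallel_a$, and is not bound by $\mathcal C$: $\;\mathcal C[a\,t\,\sigma]\parallel_a v\mapsto\mathcal C[v[\lambda y^B t/a]]\parallel_a v$ and $v\parallel_a\mathcal C[a\,t\,\sigma]\mapsto v\parallel_a\mathcal C[v[\lambda y^A t/a]]$, with $t$ a proof term and $y$ not free in $t$; - $\mathcal A\,u\,\sigma\mapsto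 u$, if $u$ and $\mathcal A\,u\,\sigma$ have the same type. *Head reduction.* The parallel processes of $t$ are the $p$ with $t=\mathcal C[p]$ for a parallel context $\mathcal C$; those not of the form $u\parallel_b v$ are the elementary processes. The head redexes of a process $p$ are: $h$, if $p=h\,\sigma$ with $h$ a redex of one of the kinds in the first two items; $p$ itself, if $p=u\parallel_a v$ is a redex by the third item; $p$ itself, if $p=\mathcal A\,u\,\sigma$ is a redex by the last item. A redex $u\parallel_a v$ starts at the leftmost elementary process $a\,t\,\sigma$ of it, $a$ being the bound variable shown, and contracting it replaces that process; every other head redex starts in the elementary process that contains it. Then $t\succ t'$ means that $t'$ arises from $t$ by contracting the leftmost (by starting position) among the head redexes of the parallel processes of $t$. Let $\mathsf{HN}^\star$ be the set of the proof terms $t$ of $\mathsf{LC}^\star$ for which there is no infinite sequence $t=t_0\succ t_1\succ t_2\succ\cdots$. **Statement.** If $t:A$ is a proof term of $\mathsf{LC}$ (possibly with free variables), then $t\in\mathsf{HN}^\star$. -/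

import Mathlib

universe u v

namespace DummettLC

/-! ## First-order language

Individual terms are the terms of Mathlib over a first-order language `L` with variables in `ℕ`
(constants are the function symbols of arity `0`). Variables are de Bruijn indices, so that
formulas and proof terms are taken up to renaming of bound variables. -/

/-- Individual terms. -/
abbrev ITerm (L : FirstOrder.Language.{u, v}) : Type u := L.Term ℕ

/-- First-order formulas; `all` and `ex` bind the individual variable of index `0`. -/
inductive Formula (L : FirstOrder.Language.{u, v}) : Type (max u v)
  | atom {n : ℕ} (P : L.Relations n) (ms : Fin n → ITerm L) : Formula L
  | bot : Formula L
  | and (A B : Formula L) : Formula L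
  | or (A B : Formula L) : Formula L
  | imp (A B : Formula L) : Formula L
  | all (A : Formula L) : Formula L
  | ex (A : Formula L) : Formula L

/-- The two classes of variables are indexed by natural numbers; this is the renaming
that crosses a binder. -/
def upRen (f : ℕ → ℕ) : ℕ → ℕ
  | 0 => 0
  | n + 1 => f n + 1

section

variable {L : FirstOrder.Language.{u, v}}

/-- Individual substitution crossing a binder of an individual variable. -/
def iup (s : ℕ → ITerm L) : ℕ → ITerm L
  | 0 => FirstOrder.Language.Term.var 0
  | n + 1 => (s n).relabel Nat.succ

/-- The individual substitution making room for a new individual variable of index `0`. -/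
def ishift : ℕ → ITerm L := fun n => FirstOrder.Language.Term.var (n + 1)

/-- The individual substitution `[m/α]`, with `α` the variable of index `0`. -/
def iinst (m : ITerm L) : ℕ → ITerm L
  | 0 => m
  | n + 1 => FirstOrder.Language.Term.var n

namespace Formula

/-- Atomic formulas; falsity is a `0`-ary predicate, hence atomic. -/
def IsAtomic : Formula L → Prop
  | atom _ _ => True
  | bot => True
  | _ => False

/-- Simultaneous capture-avoiding substitution of individual terms in a formula. -/
def isubst : (ℕ → ITerm L) → Formula L → Formula L
  | s, atom P ms => atom P (fun i => (ms i).subst s)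
  | _, bot => bot
  | s, and A B => and (A.isubst s) (B.isubst s)
  | s, or A B => or (A.isubst s) (B.isubst s)
  | s, imp A B => imp (A.isubst s) (B.isubst s)
  | s, all A => all (A.isubst (iup s))
  | s, ex A => ex (A.isubst (iup s))

end Formula

end

/-! ## Proof terms -/

/-- Raw proof terms of `LC⋆`, in Church style, with de Bruijn indices for the proof term variables
and, separately, for the individual variables. In the indices `i`, `false` is `0` and
`true` is `1`. -/
inductive ProofTerm (L : FirstOrder.Language.{u, v}) : Type (max u v)
  /-- a proof term variable -/
  | var (n : ℕ) : ProofTerm L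
  /-- the abort constant of type `A → B` -/
  | abort (A B : Formula L) : ProofTerm L
  /-- `⟨t, u⟩` -/
  | pair (t u : ProofTerm L) : ProofTerm L
  /-- `t π_i` -/
  | proj (t : ProofTerm L) (i : Bool) : ProofTerm L
  /-- `λ x^A t`, binding the proof term variable `0` in `t` -/
  | lam (A : Formula L) (t : ProofTerm L) : ProofTerm L
  /-- `t u` -/
  | app (t u : ProofTerm L) : ProofTerm L
  /-- `ι_i(t)` -/
  | inj (i : Bool) (t : ProofTerm L) : ProofTerm L
  /-- `t [x^A.w₁, y^B.w₂]`, binding the proof term variable `0` in `w₁` and in `w₂` -/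
  | case (t : ProofTerm L) (A : Formula L) (w₁ : ProofTerm L) (B : Formula L)
      (w₂ : ProofTerm L) : ProofTerm L
  /-- `λ α t`, binding the individual variable `0` in `t` -/
  | ilam (t : ProofTerm L) : ProofTerm L
  /-- `t m` -/
  | iapp (t : ProofTerm L) (m : ITerm L) : ProofTerm L
  /-- `(m, t)` -/
  | ipair (m : ITerm L) (t : ProofTerm L) : ProofTerm L
  /-- `t [(α, x^A).w]`, binding the individual variable `0` in `A` and in `w` and the proof term
  variable `0` in `w` -/
  | icase (t : ProofTerm L) (A : Formula L) (w : ProofTerm L) : ProofTerm L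
  /-- `u ∥_a v`, binding the proof term variable `0`, that is `a`, in `u` with type `A → B` and in
  `v` with type `B → A` -/
  | par (A B : Formula L) (u v : ProofTerm L) : ProofTerm L
  /-- `efq_P(t)` -/
  | efq (P : Formula L) (t : ProofTerm L) : ProofTerm L

section

variable {L : FirstOrder.Language.{u, v}}

namespace ProofTerm

/-- Simultaneous substitution of individual terms in a proof term. -/
def isubst : (ℕ → ITerm L) → ProofTerm L → ProofTerm L
  | _, var n => var n
  | s, abort A B => abort (A.isubst s) (B.isubst s)
  | s, pair t u => pair (t.isubst s) (u.isubst s)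
  | s, proj t i => proj (t.isubst s) i
  | s, lam A t => lam (A.isubst s) (t.isubst s)
  | s, app t u => app (t.isubst s) (u.isubst s)
  | s, inj i t => inj i (t.isubst s)
  | s, case t A w₁ B w₂ =>
      case (t.isubst s) (A.isubst s) (w₁.isubst s) (B.isubst s) (w₂.isubst s)
  | s, ilam t => ilam (t.isubst (iup s))
  | s, iapp t m => iapp (t.isubst s) (m.subst s)
  | s, ipair m t => ipair (m.subst s) (t.isubst s)
  | s, icase t A w => icase (t.isubst s) (A.isubst (iup s)) (w.isubst (iup s))
  | s, par A B u v => par (A.isubst s) (B.isubst s) (u.isubst s) (v.isubst s)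
  | s, efq P t => efq (P.isubst s) (t.isubst s)

/-- Renaming of the free proof term variables. -/
def rename : (ℕ → ℕ) → ProofTerm L → ProofTerm L
  | f, var n => var (f n)
  | _, abort A B => abort A B
  | f, pair t u => pair (t.rename f) (u.rename f)
  | f, proj t i => proj (t.rename f) i
  | f, lam A t => lam A (t.rename (upRen f))
  | f, app t u => app (t.rename f) (u.rename f)
  | f, inj i t => inj i (t.rename f)
  | f, case t A w₁ B w₂ =>
      case (t.rename f) A (w₁.rename (upRen f)) B (w₂.rename (upRen f))
  | f, ilam t => ilam (t.rename f)
  | f, iapp t m => iapp (t.rename f) m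
  | f, ipair m t => ipair m (t.rename f)
  | f, icase t A w => icase (t.rename f) A (w.rename (upRen f))
  | f, par A B u v => par A B (u.rename (upRen f)) (v.rename (upRen f))
  | f, efq P t => efq P (t.rename f)

/-- Weakening by a new proof term variable of index `0`. -/
def shift (t : ProofTerm L) : ProofTerm L := t.rename Nat.succ

/-- Substitution crossing a binder of a proof term variable. -/
def up (s : ℕ → ProofTerm L) : ℕ → ProofTerm L
  | 0 => var 0
  | n + 1 => (s n).shift

/-- Simultaneous capture-avoiding substitution of proof terms for proof term variables. -/
def subst : (ℕ → ProofTerm L) → ProofTerm L → ProofTerm L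
  | s, var n => s n
  | _, abort A B => abort A B
  | s, pair t u => pair (t.subst s) (u.subst s)
  | s, proj t i => proj (t.subst s) i
  | s, lam A t => lam A (t.subst (up s))
  | s, app t u => app (t.subst s) (u.subst s)
  | s, inj i t => inj i (t.subst s)
  | s, case t A w₁ B w₂ =>
      case (t.subst s) A (w₁.subst (up s)) B (w₂.subst (up s))
  | s, ilam t => ilam (t.subst (fun n => (s n).isubst ishift))
  | s, iapp t m => iapp (t.subst s) m
  | s, ipair m t => ipair m (t.subst s)
  | s, icase t A w => icase (t.subst s) A (w.subst (up (fun n => (s n).isubst ishift)))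
  | s, par A B u v => par A B (u.subst (up s)) (v.subst (up s))
  | s, efq P t => efq P (t.subst s)

/-- The substitution `[u/x]`, with `x` the proof term variable of index `0`. -/
def inst (u : ProofTerm L) : ℕ → ProofTerm L
  | 0 => u
  | n + 1 => var n

/-- The number of elementary processes of a proof term. -/
def numProc : ProofTerm L → ℕ
  | par _ _ u v => u.numProc + v.numProc
  | _ => 1

end ProofTerm

/-! ## Typing -/

/-- Typing contexts: the types of the proof term variables `0, 1, 2, …`. -/
abbrev Ctx (L : FirstOrder.Language.{u, v}) : Type (max u v) := List (Formula L)

/-- The context seen under a binder of an individual variable: the bound variable (of index `0`)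
occurs in none of its formulas. -/
def Ctx.lift (Γ : Ctx L) : Ctx L := Γ.map (Formula.isubst ishift)

/-- The two type systems. -/
inductive System
  /-- first-order Dummett logic -/
  | LC
  /-- its extension by the abort constants -/
  | LCstar

open ProofTerm Formula in
/-- `Typed S Γ t A`: the proof term `t` has type `A` in the system `S`, its free variables having
the types given by `Γ`. -/
inductive Typed (S : System) : Ctx L → ProofTerm L → Formula L → Prop
  | var {Γ : Ctx L} {n : ℕ} {A : Formula L} :
      Γ[n]? = some A → Typed S Γ (var n) A
  | pair {Γ : Ctx L} {t u : ProofTerm L} {A B : Formula L} :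
      Typed S Γ t A → Typed S Γ u B → Typed S Γ (pair t u) (and A B)
  | proj_zero {Γ : Ctx L} {t : ProofTerm L} {A B : Formula L} :
      Typed S Γ t (and A B) → Typed S Γ (proj t false) A
  | proj_one {Γ : Ctx L} {t : ProofTerm L} {A B : Formula L} :
      Typed S Γ t (and A B) → Typed S Γ (proj t true) B
  | app {Γ : Ctx L} {t u : ProofTerm L} {A B : Formula L} :
      Typed S Γ t (imp A B) → Typed S Γ u A → Typed S Γ (app t u) B
  | lam {Γ : Ctx L} {t : ProofTerm L} {A B : Formula L} :
      Typed S (A :: Γ) t B → Typed S Γ (lam A t) (imp A B)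
  | inj_zero {Γ : Ctx L} {t : ProofTerm L} {A B : Formula L} :
      Typed S Γ t A → Typed S Γ (inj false t) (or A B)
  | inj_one {Γ : Ctx L} {t : ProofTerm L} {A B : Formula L} :
      Typed S Γ t B → Typed S Γ (inj true t) (or A B)
  | case {Γ : Ctx L} {t w₁ w₂ : ProofTerm L} {A B C : Formula L} :
      Typed S Γ t (or A B) → Typed S (A :: Γ) w₁ C → Typed S (B :: Γ) w₂ C →
      Typed S Γ (case t A w₁ B w₂) C
  | iapp {Γ : Ctx L} {t : ProofTerm L} {A : Formula L} (m : ITerm L) :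
      Typed S Γ t (all A) → Typed S Γ (iapp t m) (A.isubst (iinst m))
  | ilam {Γ : Ctx L} {t : ProofTerm L} {A : Formula L} :
      Typed S Γ.lift t A → Typed S Γ (ilam t) (all A)
  | ipair {Γ : Ctx L} {t : ProofTerm L} {A : Formula L} (m : ITerm L) :
      Typed S Γ t (A.isubst (iinst m)) → Typed S Γ (ipair m t) (ex A)
  | icase {Γ : Ctx L} {t w : ProofTerm L} {A C : Formula L} :
      Typed S Γ t (ex A) → Typed S (A :: Γ.lift) w (C.isubst ishift) →
      Typed S Γ (icase t A w) C
  | par {Γ : Ctx L} {u v : ProofTerm L} {A B C : Formula L} :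
      Typed S (imp A B :: Γ) u C → Typed S (imp B A :: Γ) v C →
      Typed S Γ (par A B u v) C
  | efq {Γ : Ctx L} {t : ProofTerm L} {P : Formula L} :
      P.IsAtomic → Typed S Γ t bot → Typed S Γ (efq P t) P
  | abort {Γ : Ctx L} (A B : Formula L) :
      S = System.LCstar → Typed S Γ (abort A B) (imp A B)

/-! ## Stacks and parallel contexts -/

/-- The entries of stacks, that is, stacks of length one. -/
inductive Entry (L : FirstOrder.Language.{u, v}) : Type (max u v)
  | arg (u : ProofTerm L) : Entry L
  | iarg (m : ITerm L) : Entry L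
  | proj (i : Bool) : Entry L
  | case (A : Formula L) (w₁ : ProofTerm L) (B : Formula L) (w₂ : ProofTerm L) : Entry L
  | icase (A : Formula L) (w : ProofTerm L) : Entry L

/-- Stacks. -/
abbrev Stack (L : FirstOrder.Language.{u, v}) : Type (max u v) := List (Entry L)

/-- The proof term `t ξ`. -/
def ProofTerm.elim (t : ProofTerm L) : Entry L → ProofTerm L
  | .arg u => t.app u
  | .iarg m => t.iapp m
  | .proj i => t.proj i
  | .case A w₁ B w₂ => t.case A w₁ B w₂
  | .icase A w => t.icase A w

/-- The proof term `t σ = (((t σ₁) σ₂) … σₙ)`. -/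
def ProofTerm.stack (t : ProofTerm L) (σ : Stack L) : ProofTerm L := σ.foldl ProofTerm.elim t

/-- Weakening of a stack entry by a new proof term variable of index `0`. -/
def Entry.shift : Entry L → Entry L
  | .arg u => .arg u.shift
  | .iarg m => .iarg m
  | .proj i => .proj i
  | .case A w₁ B w₂ => .case A (w₁.rename (upRen Nat.succ)) B (w₂.rename (upRen Nat.succ))
  | .icase A w => .icase A (w.rename (upRen Nat.succ))

/-- Parallel contexts. -/
inductive ParCtx (L : FirstOrder.Language.{u, v}) : Type (max u v)
  /-- `[]` -/
  | hole : ParCtx L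
  /-- `C[] ∥_a v` -/
  | left (A B : Formula L) (C : ParCtx L) (v : ProofTerm L) : ParCtx L
  /-- `u ∥_a C[]` -/
  | right (A B : Formula L) (u : ProofTerm L) (C : ParCtx L) : ParCtx L

namespace ParCtx

/-- `C[t]`, where the binders of `C` may bind variables of `t`. -/
def fill : ParCtx L → ProofTerm L → ProofTerm L
  | hole, t => t
  | left A B C v, t => .par A B (C.fill t) v
  | right A B u C, t => .par A B u (C.fill t)

/-- The number of binders that a parallel context puts around its hole. -/
def depth : ParCtx L → ℕ
  | hole => 0
  | left _ _ C _ => C.depth + 1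
  | right _ _ _ C => C.depth + 1

/-- The number of elementary processes to the left of the hole. -/
def numLeft : ParCtx L → ℕ
  | hole => 0
  | left _ _ C _ => C.numLeft
  | right _ _ u C => u.numProc + C.numLeft

/-- The typing context at the hole. -/
def ctx : ParCtx L → Ctx L → Ctx L
  | hole, Γ => Γ
  | left A B C _, Γ => C.ctx (.imp A B :: Γ)
  | right A B _ C, Γ => C.ctx (.imp B A :: Γ)

end ParCtx

/-! ## Head reduction -/

open ProofTerm in
/-- The intuitionistic reductions and the permutation rules for the parallel operator. Their
redexes are of the form `t ξ` with `ξ` a stack entry. -/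
inductive ElimRed : ProofTerm L → ProofTerm L → Prop
  | beta (A : Formula L) (t u : ProofTerm L) :
      ElimRed (app (lam A t) u) (t.subst (inst u))
  | ibeta (t : ProofTerm L) (m : ITerm L) :
      ElimRed (iapp (ilam t) m) (t.isubst (iinst m))
  | proj_zero (t u : ProofTerm L) : ElimRed (proj (pair t u) false) t
  | proj_one (t u : ProofTerm L) : ElimRed (proj (pair t u) true) u
  | case_zero (t : ProofTerm L) (A : Formula L) (w₁ : ProofTerm L) (B : Formula L)
      (w₂ : ProofTerm L) :
      ElimRed (case (inj false t) A w₁ B w₂) (w₁.subst (inst t))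
  | case_one (t : ProofTerm L) (A : Formula L) (w₁ : ProofTerm L) (B : Formula L)
      (w₂ : ProofTerm L) :
      ElimRed (case (inj true t) A w₁ B w₂) (w₂.subst (inst t))
  | icase (m : ITerm L) (t : ProofTerm L) (A : Formula L) (w : ProofTerm L) :
      ElimRed (icase (ipair m t) A w) ((w.isubst (iinst m)).subst (inst t))
  | perm (A B : Formula L) (u v : ProofTerm L) (ξ : Entry L) :
      ElimRed ((par A B u v).elim ξ) (par A B (u.elim ξ.shift) (v.elim ξ.shift))

/-- The substitution `[r/a]` applied to one side of `u ∥_a v` when the result is moved to the other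
side, under the `k` binders of a parallel context; the variables free in `u ∥_a v`
are renamed accordingly. -/
def sendSubst (k : ℕ) (r : ProofTerm L) : ℕ → ProofTerm L
  | 0 => r
  | n + 1 => .var (n + 1 + k)

open ProofTerm in
/-- `HeadContract Γ n p p'`: in the typing context `Γ`, the proof term `p'` is obtained from `p`
by contracting a head redex of `p`, and that redex starts in the elementary process number `n`
(counted from the left, from `0`) of `p`.
A redex `u ∥_a v` starts at an occurrence of `a` in an elementary process `a t σ`,
and it is that elementary process which is replaced. In the first rule, `a` is the variable
of index `C.depth` at the hole of `C`. -/
inductive HeadContract (Γ : Ctx L) : ℕ → ProofTerm L → ProofTerm L → Prop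
  | comm_left (A B : Formula L) (C : ParCtx L) (t v : ProofTerm L) (σ : Stack L) :
      HeadContract Γ C.numLeft
        (par A B (C.fill ((app (var C.depth) t).stack σ)) v)
        (par A B (C.fill (v.subst (sendSubst C.depth (lam B t.shift)))) v)
  | comm_right (A B : Formula L) (C : ParCtx L) (t u : ProofTerm L) (σ : Stack L) :
      HeadContract Γ (u.numProc + C.numLeft)
        (par A B u (C.fill ((app (var C.depth) t).stack σ)))
        (par A B u (C.fill (u.subst (sendSubst C.depth (lam A t.shift)))))
  | elim {r r' : ProofTerm L} (σ : Stack L) :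
      ElimRed r r' → HeadContract Γ 0 (r.stack σ) (r'.stack σ)
  | abort {A B D : Formula L} {t : ProofTerm L} {σ : Stack L} :
      Typed System.LCstar Γ t D →
      Typed System.LCstar Γ ((app (abort A B) t).stack σ) D →
      HeadContract Γ 0 ((app (abort A B) t).stack σ) t

/-- Head reduction `t ≻ t'` of `LC⋆`, for proof terms whose free variables have the types given by
`Γ`: contract the leftmost among the head redexes of the parallel processes of `t`. The parallel
processes of `t` are the `p` with `t = C[p]` for a parallel context `C`. An elementary process
contains the start of at most one head redex, so the redexes are ordered by the elementary process
in which they start. -/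
def HeadRed (Γ : Ctx L) (t t' : ProofTerm L) : Prop :=
  ∃ (C : ParCtx L) (n : ℕ) (p p' : ProofTerm L),
    t = C.fill p ∧ t' = C.fill p' ∧ HeadContract (C.ctx Γ) n p p' ∧
    ∀ (D : ParCtx L) (m : ℕ) (q q' : ProofTerm L),
      t = D.fill q → HeadContract (D.ctx Γ) m q q' → C.numLeft + n ≤ D.numLeft + m

/-- `HN⋆`: the proof terms of `LC⋆` that have no infinite head reduction, where the free
variables have the types given by `Γ`. -/
def HNstar (Γ : Ctx L) : Set (ProofTerm L) :=
  {t | (∃ A, Typed System.LCstar Γ t A) ∧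
    ¬ ∃ f : ℕ → ProofTerm L, f 0 = t ∧ ∀ n, HeadRed Γ (f n) (f (n + 1))}

end

end DummettLC

/-!
Head reduction of a proof term of `LC` evaluates its elementary processes from the left to the
right, and this evaluation is described by the inductive predicate `Norm`. Inside `u ∥_a v`,
the component `u` is evaluated first, and `a` then acts as a constant that aborts the process
`a t σ` and continues with `v[λ y t/a]`. When `v` is evaluated, no head redex
starts in `u` any more, and none starts in `u[λ y t/a]` either, because no elementary process of
`u` applies `a` to a proof term at its head. Hence a call of `a` in `v` stops at once, as if `a`
were free (`Idle.subst`, `Norm.acc`).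

Termination of the evaluation is proved by reducibility (`adequacy`). The reducible proof terms of
a type are those whose evaluation terminates on all reducible stacks of the type. Evaluation
takes place in an environment that records the components still pending around a process, and
reducibility is a Kripke relation over the extensions of the environment. Its decisive instance is
`Adequate.par`: the constant `a` passing its argument to the pending process `v` is reducible,
whatever its codomain and the type of `v` are, since by induction `v` terminates for all reducible
values of `a`. Individual terms play no role in the definition of reducible stacks, so that
quantifiers need no reducibility candidates.

Finally, `HeadRed.parRed` shows that head reduction of proof terms without abort constants is
reduction from the left to the right: a head redex starts in exactly those elementary processes
that are active (`Active.exists_headContract`). As reduction creates no abort constants, the typing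
conditions in the definition of head reduction never matter, and subject reduction is not needed.
-/

namespace DummettLC

section

variable {L : FirstOrder.Language.{u, v}}

/-! ### Substitution calculus -/

theorem ITerm.subst_relabel (m : ITerm L) (f : ℕ → ℕ) (s : ℕ → ITerm L) :
    FirstOrder.Language.Term.subst (m.relabel f) s = m.subst (s ∘ f) := by
  induction m with
  | var n => rfl
  | func g ms ih =>
    simp only [FirstOrder.Language.Term.relabel, FirstOrder.Language.Term.subst, ih]

theorem ITerm.relabel_subst (m : ITerm L) (s : ℕ → ITerm L) (f : ℕ → ℕ) :
    FirstOrder.Language.Term.relabel f (m.subst s) = m.subst (fun n => (s n).relabel f) := by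
  induction m with
  | var n => rfl
  | func g ms ih =>
    simp only [FirstOrder.Language.Term.relabel, FirstOrder.Language.Term.subst, ih]

theorem ITerm.subst_subst (m : ITerm L) (s r : ℕ → ITerm L) :
    FirstOrder.Language.Term.subst (m.subst s) r = m.subst (fun n => (s n).subst r) := by
  induction m with
  | var n => rfl
  | func g ms ih => simp only [FirstOrder.Language.Term.subst, ih]

theorem ITerm.subst_var (m : ITerm L) :
    FirstOrder.Language.Term.subst m FirstOrder.Language.Term.var = m := by
  induction m with
  | var n => rfl
  | func g ms ih => simp only [FirstOrder.Language.Term.subst, ih]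

theorem iup_comp (s r : ℕ → ITerm L) :
    (fun n => (iup s n).subst (iup r)) = iup (fun n => (s n).subst r) := by
  funext n
  cases n with
  | zero => rfl
  | succ n =>
    simp only [iup, ITerm.subst_relabel, ITerm.relabel_subst]
    rfl

theorem iup_var :
    iup (FirstOrder.Language.Term.var : ℕ → ITerm L) = FirstOrder.Language.Term.var := by
  funext n
  cases n <;> rfl

namespace Formula

theorem isubst_isubst (A : Formula L) (s r : ℕ → ITerm L) :
    (A.isubst s).isubst r = A.isubst (fun n => (s n).subst r) := by
  induction A generalizing s r <;> simp_all [isubst, ITerm.subst_subst, iup_comp]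

theorem isubst_var (A : Formula L) : A.isubst FirstOrder.Language.Term.var = A := by
  induction A <;> simp_all [isubst, ITerm.subst_var, iup_var]

end Formula

theorem upRen_comp (f g : ℕ → ℕ) : upRen g ∘ upRen f = upRen (g ∘ f) := by
  funext n
  cases n <;> rfl

namespace ProofTerm

theorem isubst_isubst (t : ProofTerm L) (s r : ℕ → ITerm L) :
    (t.isubst s).isubst r = t.isubst (fun n => (s n).subst r) := by
  induction t generalizing s r <;>
    simp_all [isubst, ITerm.subst_subst, iup_comp, Formula.isubst_isubst]

theorem isubst_var (t : ProofTerm L) : t.isubst FirstOrder.Language.Term.var = t := by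
  induction t <;> simp_all [isubst, ITerm.subst_var, iup_var, Formula.isubst_var]

theorem isubst_rename (t : ProofTerm L) (f : ℕ → ℕ) (s : ℕ → ITerm L) :
    (t.rename f).isubst s = (t.isubst s).rename f := by
  induction t generalizing f s <;> simp_all [isubst, rename]

theorem rename_rename (t : ProofTerm L) (f g : ℕ → ℕ) :
    (t.rename f).rename g = t.rename (g ∘ f) := by
  induction t generalizing f g <;> simp_all [rename, upRen_comp]

theorem rename_shift (t : ProofTerm L) (f : ℕ → ℕ) :
    t.shift.rename (upRen f) = (t.rename f).shift := by
  simp only [shift, rename_rename]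
  rfl

theorem up_comp_upRen (f : ℕ → ℕ) (s : ℕ → ProofTerm L) : up s ∘ upRen f = up (s ∘ f) := by
  funext n
  cases n <;> rfl

theorem subst_rename (t : ProofTerm L) (f : ℕ → ℕ) (s : ℕ → ProofTerm L) :
    (t.rename f).subst s = t.subst (s ∘ f) := by
  induction t generalizing f s <;>
    simp_all [subst, rename, up_comp_upRen] <;> rfl

theorem rename_up (s : ℕ → ProofTerm L) (f : ℕ → ℕ) :
    (fun n => (up s n).rename (upRen f)) = up (fun n => (s n).rename f) := by
  funext n
  cases n with
  | zero => rfl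
  | succ n => exact rename_shift _ _

theorem rename_subst (t : ProofTerm L) (s : ℕ → ProofTerm L) (f : ℕ → ℕ) :
    (t.subst s).rename f = t.subst (fun n => (s n).rename f) := by
  induction t generalizing f s <;>
    simp_all [subst, rename, rename_up, isubst_rename]

theorem isubst_up (s : ℕ → ProofTerm L) (r : ℕ → ITerm L) :
    (fun n => (up s n).isubst r) = up (fun n => (s n).isubst r) := by
  funext n
  cases n with
  | zero => rfl
  | succ n => exact isubst_rename _ _ _

theorem isubst_ishift (t : ProofTerm L) (r : ℕ → ITerm L) :
    (t.isubst ishift).isubst (iup r) = (t.isubst r).isubst ishift := by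
  simp only [isubst_isubst]
  congr 1
  funext n
  change (r n).relabel Nat.succ = _
  generalize r n = m
  induction m with
  | var n => rfl
  | func g ms ih =>
    simp only [FirstOrder.Language.Term.relabel, FirstOrder.Language.Term.subst, ih]

theorem isubst_subst (t : ProofTerm L) (s : ℕ → ProofTerm L) (r : ℕ → ITerm L) :
    (t.subst s).isubst r = (t.isubst r).subst (fun n => (s n).isubst r) := by
  induction t generalizing s r <;>
    simp_all [subst, isubst, isubst_up, isubst_ishift]

theorem subst_up (s r : ℕ → ProofTerm L) :
    (fun n => (up s n).subst (up r)) = up (fun n => (s n).subst r) := by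
  funext n
  cases n with
  | zero => rfl
  | succ n =>
    simp only [up, shift, subst_rename, rename_subst]
    rfl

theorem subst_subst (t : ProofTerm L) (s r : ℕ → ProofTerm L) :
    (t.subst s).subst r = t.subst (fun n => (s n).subst r) := by
  induction t generalizing s r <;>
    simp_all [subst, subst_up, isubst_subst]

theorem up_var : up (var : ℕ → ProofTerm L) = var := by
  funext n
  cases n <;> rfl

theorem subst_var (t : ProofTerm L) : t.subst var = t := by
  induction t <;> simp_all [subst, isubst, up_var]

theorem rename_eq_subst (t : ProofTerm L) (f : ℕ → ℕ) :
    t.rename f = t.subst (fun n => var (f n)) := by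
  rw [← subst_var (t.rename f), subst_rename]
  rfl

/-- The substitution of `u` for the variable `0` that maps the variable `n + 1` to `s n`. -/
def scons (u : ProofTerm L) (s : ℕ → ProofTerm L) : ℕ → ProofTerm L
  | 0 => u
  | n + 1 => s n

theorem subst_up_subst_inst (t u : ProofTerm L) (s : ℕ → ProofTerm L) :
    (t.subst (up s)).subst (inst u) = t.subst (scons u s) := by
  rw [subst_subst]
  congr 1
  funext n
  cases n with
  | zero => rfl
  | succ n =>
    simp only [up, shift, subst_rename]
    exact subst_var _

theorem isubst_ishift_iinst (t : ProofTerm L) (m : ITerm L) :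
    (t.isubst ishift).isubst (iinst m) = t := by
  rw [isubst_isubst]
  exact isubst_var t

end ProofTerm

/-- Renaming of the free proof term variables of a stack entry. -/
def Entry.rename (f : ℕ → ℕ) : Entry L → Entry L
  | .arg u => .arg (u.rename f)
  | .iarg m => .iarg m
  | .proj i => .proj i
  | .case A w₁ B w₂ => .case A (w₁.rename (upRen f)) B (w₂.rename (upRen f))
  | .icase A w => .icase A (w.rename (upRen f))

/-- Substitution of proof terms in a stack entry. -/
def Entry.subst (s : ℕ → ProofTerm L) : Entry L → Entry L
  | .arg u => .arg (u.subst s)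
  | .iarg m => .iarg m
  | .proj i => .proj i
  | .case A w₁ B w₂ => .case A (w₁.subst (ProofTerm.up s)) B (w₂.subst (ProofTerm.up s))
  | .icase A w => .icase A (w.subst (ProofTerm.up (fun n => (s n).isubst ishift)))

theorem Entry.shift_eq_rename (ξ : Entry L) : ξ.shift = ξ.rename Nat.succ := by
  cases ξ <;> rfl

theorem Entry.rename_rename (ξ : Entry L) (f g : ℕ → ℕ) :
    (ξ.rename f).rename g = ξ.rename (g ∘ f) := by
  cases ξ <;> simp [Entry.rename, ProofTerm.rename_rename, upRen_comp]

theorem Entry.subst_rename (ξ : Entry L) (f : ℕ → ℕ) (s : ℕ → ProofTerm L) :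
    (ξ.rename f).subst s = ξ.subst (s ∘ f) := by
  cases ξ <;>
    simp [Entry.rename, Entry.subst, ProofTerm.subst_rename, ProofTerm.up_comp_upRen]
  rfl

theorem Entry.rename_eq_subst (ξ : Entry L) (f : ℕ → ℕ) :
    ξ.rename f = ξ.subst (fun n => .var (f n)) := by
  have h : ProofTerm.up (fun n => .var (f n)) = fun n => (.var (upRen f n) : ProofTerm L) := by
    funext n
    cases n <;> rfl
  cases ξ <;> simp [Entry.rename, Entry.subst, ProofTerm.rename_eq_subst, h, ProofTerm.isubst]

theorem ProofTerm.subst_elim (t : ProofTerm L) (ξ : Entry L) (s : ℕ → ProofTerm L) :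
    (t.elim ξ).subst s = (t.subst s).elim (ξ.subst s) := by
  cases ξ <;> rfl

theorem ProofTerm.subst_stack (t : ProofTerm L) (σ : Stack L) (s : ℕ → ProofTerm L) :
    (t.stack σ).subst s = (t.subst s).stack (σ.map (Entry.subst s)) := by
  induction σ generalizing t with
  | nil => rfl
  | cons ξ σ ih => exact (ih _).trans (by rw [subst_elim]; rfl)

theorem ProofTerm.stack_concat (t : ProofTerm L) (ξ : Entry L) (σ : Stack L) :
    t.stack (σ ++ [ξ]) = (t.stack σ).elim ξ := by
  simp [ProofTerm.stack]

/-! ### Elementary processes as a head with a stack -/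

/-- The proof terms that are not eliminations `t ξ`. -/
def ProofTerm.IsHead : ProofTerm L → Prop
  | app _ _ | iapp _ _ | proj _ _ | case _ _ _ _ _ | icase _ _ _ => False
  | _ => True

theorem ProofTerm.isHead_var (n : ℕ) : (var n : ProofTerm L).IsHead := trivial

theorem ProofTerm.not_isHead_elim (t : ProofTerm L) (ξ : Entry L) : ¬(t.elim ξ).IsHead := by
  cases ξ <;> exact id

theorem ProofTerm.elim_inj {t t' : ProofTerm L} {ξ ξ' : Entry L} (h : t.elim ξ = t'.elim ξ') :
    t = t' ∧ ξ = ξ' := by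
  cases ξ <;> cases ξ' <;> simp_all [ProofTerm.elim]

theorem ProofTerm.exists_eq_stack (p : ProofTerm L) :
    ∃ (h : ProofTerm L) (σ : Stack L), h.IsHead ∧ p = h.stack σ := by
  have key : ∀ (t : ProofTerm L) (ξ : Entry L),
      (∃ (h : ProofTerm L) (σ : Stack L), h.IsHead ∧ t = h.stack σ) →
      ∃ (h : ProofTerm L) (σ : Stack L), h.IsHead ∧ t.elim ξ = h.stack σ := by
    rintro _ ξ ⟨h, σ, hh, rfl⟩
    exact ⟨h, σ ++ [ξ], hh, (stack_concat _ _ _).symm⟩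
  induction p with
  | app t u ih => exact key t (.arg u) ih
  | iapp t m ih => exact key t (.iarg m) ih
  | proj t i ih => exact key t (.proj i) ih
  | case t A w₁ B w₂ ih => exact key t (.case A w₁ B w₂) ih
  | icase t A w ih => exact key t (.icase A w) ih
  | _ =>
    refine ⟨_, [], ?_, rfl⟩
    trivial

theorem ProofTerm.stack_inj {h h' : ProofTerm L} {σ σ' : Stack L} (hh : h.IsHead)
    (hh' : h'.IsHead) (e : h.stack σ = h'.stack σ') : h = h' ∧ σ = σ' := by
  induction σ using List.reverseRecOn generalizing σ' with
  | nil =>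
    cases σ' using List.reverseRecOn with
    | nil => exact ⟨e, rfl⟩
    | append_singleton σ' ξ' =>
      rw [stack_concat] at e
      change h = _ at e
      exact (not_isHead_elim _ _ (e ▸ hh)).elim
  | append_singleton σ ξ ih =>
    cases σ' using List.reverseRecOn with
    | nil =>
      rw [stack_concat] at e
      change _ = h' at e
      exact (not_isHead_elim _ _ (e ▸ hh')).elim
    | append_singleton σ' ξ' =>
      rw [stack_concat, stack_concat] at e
      obtain ⟨e', rfl⟩ := elim_inj e
      obtain ⟨rfl, rfl⟩ := ih e'
      exact ⟨rfl, rfl⟩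

/-- The result of contracting `t ξ` by an intuitionistic reduction or by a permutation,
if that is a redex. -/
def ProofTerm.contract : ProofTerm L → Entry L → Option (ProofTerm L)
  | lam _ t, .arg u => some (t.subst (inst u))
  | ilam t, .iarg m => some (t.isubst (iinst m))
  | pair t _, .proj false => some t
  | pair _ u, .proj true => some u
  | inj false t, .case _ w₁ _ _ => some (w₁.subst (inst t))
  | inj true t, .case _ _ _ w₂ => some (w₂.subst (inst t))
  | ipair m t, .icase _ w => some ((w.isubst (iinst m)).subst (inst t))
  | par A B u v, ξ => some (par A B (u.elim ξ.shift) (v.elim ξ.shift))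
  | _, _ => none

theorem ElimRed.exists_contract {r r' : ProofTerm L} (h : ElimRed r r') :
    ∃ t ξ, r = ProofTerm.elim t ξ ∧ t.contract ξ = some r' := by
  cases h with
  | beta A t u => exact ⟨_, .arg u, rfl, rfl⟩
  | ibeta t m => exact ⟨_, .iarg m, rfl, rfl⟩
  | proj_zero t u => exact ⟨_, .proj false, rfl, rfl⟩
  | proj_one t u => exact ⟨_, .proj true, rfl, rfl⟩
  | case_zero t A w₁ B w₂ => exact ⟨_, .case A w₁ B w₂, rfl, rfl⟩
  | case_one t A w₁ B w₂ => exact ⟨_, .case A w₁ B w₂, rfl, rfl⟩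
  | icase m t A w => exact ⟨_, .icase A w, rfl, rfl⟩
  | perm A B u v ξ => exact ⟨_, ξ, rfl, by cases ξ <;> rfl⟩

theorem ProofTerm.elimRed_of_contract {t r : ProofTerm L} {ξ : Entry L}
    (h : t.contract ξ = some r) : ElimRed (t.elim ξ) r := by
  unfold contract at h
  split at h <;> cases h <;> constructor

theorem ProofTerm.isHead_of_contract {t r : ProofTerm L} {ξ : Entry L}
    (h : t.contract ξ = some r) : t.IsHead := by
  unfold contract at h
  split at h <;> trivial

/-- `StackRed p p'`: the proof term `p'` arises from `p = r σ` by contracting a redex `r` that is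
an elimination. -/
def StackRed (p p' : ProofTerm L) : Prop :=
  ∃ (h : ProofTerm L) (ξ : Entry L) (σ : Stack L) (r : ProofTerm L),
    p = h.stack (ξ :: σ) ∧ h.contract ξ = some r ∧ p' = r.stack σ

theorem ElimRed.stackRed {r r' : ProofTerm L} (h : ElimRed r r') (σ : Stack L) :
    StackRed (r.stack σ) (r'.stack σ) := by
  obtain ⟨t, ξ, rfl, e⟩ := h.exists_contract
  exact ⟨t, ξ, σ, r', rfl, e, rfl⟩

theorem stackRed_stack_iff {h p' : ProofTerm L} {σ : Stack L} (hh : h.IsHead) :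
    StackRed (h.stack σ) p' ↔
      ∃ ξ τ r, σ = ξ :: τ ∧ h.contract ξ = some r ∧ p' = r.stack τ := by
  constructor
  · rintro ⟨h', ξ, τ, r, e, e', rfl⟩
    obtain ⟨rfl, rfl⟩ := ProofTerm.stack_inj hh (ProofTerm.isHead_of_contract e') e
    exact ⟨ξ, τ, r, rfl, e', rfl⟩
  · rintro ⟨ξ, τ, r, rfl, e', rfl⟩
    exact ⟨h, ξ, τ, r, rfl, e', rfl⟩

theorem StackRed.unique {p p₁ p₂ : ProofTerm L} (h₁ : StackRed p p₁) (h₂ : StackRed p p₂) :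
    p₁ = p₂ := by
  obtain ⟨h, ξ, σ, r, rfl, e, rfl⟩ := h₁
  obtain ⟨ξ', σ', r', e', e'', rfl⟩ := (stackRed_stack_iff (ProofTerm.isHead_of_contract e)).1 h₂
  cases e'
  rw [e] at e''
  cases e''
  rfl

/-- `Calls n t p`: the proof term `p` is of the form `x t σ` with `x` the variable `n`. -/
def Calls (n : ℕ) (t p : ProofTerm L) : Prop :=
  ∃ σ : Stack L, p = (ProofTerm.var n).stack (.arg t :: σ)

theorem calls_stack_iff {n : ℕ} {h t : ProofTerm L} {σ : Stack L} (hh : h.IsHead) :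
    Calls n t (h.stack σ) ↔ h = .var n ∧ ∃ τ, σ = .arg t :: τ := by
  constructor
  · rintro ⟨τ, e⟩
    obtain ⟨rfl, rfl⟩ := ProofTerm.stack_inj hh (ProofTerm.isHead_var n) e
    exact ⟨rfl, τ, rfl⟩
  · rintro ⟨rfl, τ, rfl⟩
    exact ⟨τ, rfl⟩

theorem Calls.unique {n n' : ℕ} {t t' p : ProofTerm L} (h : Calls n t p) (h' : Calls n' t' p) :
    n = n' ∧ t = t' := by
  obtain ⟨σ, rfl⟩ := h
  obtain ⟨e, τ, e'⟩ := (calls_stack_iff (ProofTerm.isHead_var _)).1 h'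
  cases e
  cases e'
  exact ⟨rfl, rfl⟩

theorem Calls.not_stackRed {n : ℕ} {t p p' : ProofTerm L} (h : Calls n t p) :
    ¬StackRed p p' := by
  obtain ⟨σ, rfl⟩ := h
  intro h
  obtain ⟨ξ, τ, r, -, e, -⟩ := (stackRed_stack_iff (ProofTerm.isHead_var _)).1 h
  cases e

theorem ProofTerm.stack_ne_par {p : ProofTerm L} {ξ : Entry L} {σ : Stack L} {A B : Formula L}
    {u v : ProofTerm L} : p.stack (ξ :: σ) ≠ par A B u v := by
  induction σ using List.reverseRecOn with
  | nil => cases ξ <;> exact nofun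
  | append_singleton σ ξ' ih =>
    rw [← List.cons_append, stack_concat]
    cases ξ' <;> exact nofun

theorem StackRed.ne_par {p p' : ProofTerm L} (h : StackRed p p') {A B : Formula L}
    {u v : ProofTerm L} : p ≠ .par A B u v := by
  obtain ⟨h, ξ, σ, r, rfl, -, -⟩ := h
  exact ProofTerm.stack_ne_par

theorem Calls.ne_par {n : ℕ} {t p : ProofTerm L} (h : Calls n t p) {A B : Formula L}
    {u v : ProofTerm L} : p ≠ .par A B u v := by
  obtain ⟨σ, rfl⟩ := h
  exact ProofTerm.stack_ne_par

/-! ### Evaluation in an environment of pending processes -/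

/-- The binders `∥_a` around an elementary process, from the innermost one. The entry
`some (A, v)` stands for a binder whose right component `v` is still to be evaluated, where `A` is
the domain of the type of `a` in `v`; the entry `none` stands for a binder whose left component is
evaluated already. The variables beyond the end of the list are the free ones. -/
abbrev Env (L : FirstOrder.Language.{u, v}) : Type (max u v) :=
  List (Option (Formula L × ProofTerm L))

/-- `Norm E p`: the evaluation of `p` from the left to the right in the environment `E`
terminates. An elementary process `a t σ` with `a` bound to the pending process `v` continues
as `v[λ y t/a]`; an elementary process stops if no rule applies to it. -/
inductive Norm : Env L → ProofTerm L → Prop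
  | par {E : Env L} {A B : Formula L} {u v : ProofTerm L} :
      Norm (some (B, v) :: E) u → Norm (none :: E) v → Norm E (.par A B u v)
  | comm {E : Env L} {n : ℕ} {A : Formula L} {t v p : ProofTerm L} :
      E[n]? = some (some (A, v)) → Calls n t p →
      Norm E (v.subst (sendSubst n (.lam A t.shift))) → Norm E p
  | elim {E : Env L} {p p' : ProofTerm L} : StackRed p p' → Norm E p' → Norm E p
  | halt {E : Env L} {p : ProofTerm L} : (∀ A B u v, p ≠ .par A B u v) →
      (∀ p', ¬StackRed p p') →
      (∀ n A v t, E[n]? = some (some (A, v)) → ¬Calls n t p) → Norm E p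

theorem Norm.of_contract {E : Env L} {t r : ProofTerm L} {ξ : Entry L} {σ : Stack L}
    (e : t.contract ξ = some r) (h : Norm E (r.stack σ)) : Norm E (t.stack (ξ :: σ)) :=
  .elim ⟨t, ξ, σ, r, rfl, e, rfl⟩ h

theorem norm_of_isHead {E : Env L} {h : ProofTerm L} (hh : h.IsHead)
    (hp : ∀ A B u v, h ≠ .par A B u v) : Norm E h := by
  refine .halt hp (fun p' hr => ?_) (fun n A v t _ hc => ?_)
  · obtain ⟨ξ, τ, r, e, -⟩ := (stackRed_stack_iff (σ := []) hh).1 hr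
    cases e
  · obtain ⟨-, τ, e⟩ := (calls_stack_iff (σ := []) hh).1 hc
    cases e

theorem norm_var_stack {E : Env L} {n : ℕ} (hn : ∀ A v, E[n]? ≠ some (some (A, v)))
    (ρ : Stack L) : Norm E ((ProofTerm.var n).stack ρ) := by
  refine .halt (fun A B u v => ?_) (fun p' hr => ?_) (fun m A v t hm hc => ?_)
  · cases ρ with
    | nil => exact nofun
    | cons ξ ρ => exact ProofTerm.stack_ne_par
  · obtain ⟨ξ, τ, r, -, e, -⟩ := (stackRed_stack_iff (ProofTerm.isHead_var _)).1 hr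
    cases e
  · obtain ⟨e, -⟩ := (calls_stack_iff (ProofTerm.isHead_var _)).1 hc
    cases e
    exact hn A v hm

theorem Entry.subst_sendSubst (ξ : Entry L) (n : ℕ) (r : ProofTerm L) :
    ξ.shift.subst (sendSubst n r) = ξ.rename (· + (n + 1)) := by
  rw [Entry.shift_eq_rename, Entry.subst_rename, Entry.rename_eq_subst]
  congr 1
  funext i
  change ProofTerm.var _ = _
  congr 1
  omega

theorem Norm.par_stack {E : Env L} {A B : Formula L} {u v : ProofTerm L} {ρ : Stack L}
    (h : Norm E (.par A B (u.stack (ρ.map Entry.shift)) (v.stack (ρ.map Entry.shift)))) :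
    Norm E ((ProofTerm.par A B u v).stack ρ) := by
  induction ρ generalizing u v with
  | nil => exact h
  | cons ξ ρ ih => exact .of_contract (by cases ξ <;> rfl) (ih h)

/-! ### Reducibility -/

/-- The proof terms whose evaluation on all stacks in `X` terminates, in all extensions
of the environment. -/
def Orth (X : Env L → Stack L → Prop) (E : Env L) (t : ProofTerm L) : Prop :=
  ∀ (F : Env L) (ρ : Stack L), X (F ++ E) ρ →
    Norm (F ++ E) ((t.rename (· + F.length)).stack ρ)

/-- The reducible stacks of a type, in an environment. They do not depend on the individual
terms in the type. -/
def RedStack : Formula L → Env L → Stack L → Prop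
  | .atom _ _, _, ρ => ρ = []
  | .bot, _, ρ => ρ = []
  | .and A B, E, ρ => ρ = [] ∨ (∃ τ, ρ = .proj false :: τ ∧ RedStack A E τ) ∨
      ∃ τ, ρ = .proj true :: τ ∧ RedStack B E τ
  | .or A B, E, ρ => ρ = [] ∨ ∃ A' w₁ B' w₂ τ, ρ = .case A' w₁ B' w₂ :: τ ∧
      (∀ F u, Orth (RedStack A) (F ++ E) u →
        Norm (F ++ E) ((w₁.subst (.scons u (fun n => .var (n + F.length)))).stack
          (τ.map (Entry.rename (· + F.length))))) ∧
      (∀ F u, Orth (RedStack B) (F ++ E) u →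
        Norm (F ++ E) ((w₂.subst (.scons u (fun n => .var (n + F.length)))).stack
          (τ.map (Entry.rename (· + F.length)))))
  | .imp A B, E, ρ => ρ = [] ∨ ∃ u τ, ρ = .arg u :: τ ∧ Orth (RedStack A) E u ∧ RedStack B E τ
  | .all A, E, ρ => ρ = [] ∨ ∃ m τ, ρ = .iarg m :: τ ∧ RedStack A E τ
  | .ex A, E, ρ => ρ = [] ∨ ∃ A' w τ, ρ = .icase A' w :: τ ∧
      ∀ F m u, Orth (RedStack A) (F ++ E) u →
        Norm (F ++ E) (((w.isubst (iinst m)).subst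
          (.scons u (fun n => .var (n + F.length)))).stack (τ.map (Entry.rename (· + F.length))))

/-- The reducible proof terms of a type, in an environment. -/
abbrev Reducible (A : Formula L) : Env L → ProofTerm L → Prop := Orth (RedStack A)

theorem redStack_nil (A : Formula L) (E : Env L) : RedStack A E [] := by
  cases A <;> simp [RedStack]

theorem redStack_isubst (A : Formula L) (s : ℕ → ITerm L) :
    RedStack (A.isubst s) = RedStack A := by
  induction A generalizing s <;> funext E ρ <;> simp_all [RedStack, Formula.isubst]

theorem upRen_id : upRen id = id := by
  funext n
  cases n <;> rfl

theorem Entry.rename_id (ξ : Entry L) : ξ.rename id = ξ := by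
  have h (t : ProofTerm L) : t.rename id = t :=
    (t.rename_eq_subst id).trans t.subst_var
  cases ξ <;> simp [Entry.rename, upRen_id, h]

theorem add_comp_add (k l : ℕ) : ((· + l) ∘ (· + k) : ℕ → ℕ) = (· + (l + k)) := by
  funext n
  simp only [Function.comp_apply]
  omega

theorem Orth.mono {X : Env L → Stack L → Prop} {E : Env L} {t : ProofTerm L} (h : Orth X E t)
    (F : Env L) : Orth X (F ++ E) (t.rename (· + F.length)) := by
  intro G ρ hρ
  rw [ProofTerm.rename_rename, add_comp_add, ← List.length_append, ← List.append_assoc]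
  exact h (G ++ F) ρ (by rwa [List.append_assoc])

theorem Entry.map_rename_rename (τ : Stack L) (k l : ℕ) :
    (τ.map (Entry.rename (· + k))).map (Entry.rename (· + l)) =
      τ.map (Entry.rename (· + (l + k))) := by
  simp only [List.map_map, Function.comp_def, Entry.rename_rename, ← add_comp_add]

theorem ProofTerm.subst_scons_rename (w u : ProofTerm L) (k l : ℕ) :
    (w.rename (upRen (· + k))).subst (scons u (fun n => var (n + l))) =
      w.subst (scons u (fun n => var (n + (l + k)))) := by
  rw [subst_rename]
  congr 1
  funext n
  cases n with
  | zero => rfl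
  | succ n =>
    simp only [Function.comp_apply, upRen, scons]
    congr 1
    omega

theorem RedStack.mono {A : Formula L} {E : Env L} {ρ : Stack L} (h : RedStack A E ρ)
    (F : Env L) : RedStack A (F ++ E) (ρ.map (Entry.rename (· + F.length))) := by
  induction A generalizing ρ with
  | atom P ms => cases h; rfl
  | bot => cases h; rfl
  | and A B ihA ihB =>
    obtain rfl | ⟨τ, rfl, h⟩ | ⟨τ, rfl, h⟩ := h
    · exact .inl rfl
    · exact .inr (.inl ⟨_, rfl, ihA h⟩)
    · exact .inr (.inr ⟨_, rfl, ihB h⟩)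
  | or A B ihA ihB =>
    obtain rfl | ⟨A', w₁, B', w₂, τ, rfl, h₁, h₂⟩ := h
    · exact .inl rfl
    · refine .inr ⟨A', _, B', _, _, rfl, fun G u hu => ?_, fun G u hu => ?_⟩
      · rw [ProofTerm.subst_scons_rename, Entry.map_rename_rename, ← List.length_append,
          ← List.append_assoc]
        exact h₁ (G ++ F) u (by rwa [List.append_assoc])
      · rw [ProofTerm.subst_scons_rename, Entry.map_rename_rename, ← List.length_append,
          ← List.append_assoc]
        exact h₂ (G ++ F) u (by rwa [List.append_assoc])
  | imp A B ihA ihB =>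
    obtain rfl | ⟨u, τ, rfl, hu, h⟩ := h
    · exact .inl rfl
    · exact .inr ⟨_, _, rfl, hu.mono F, ihB h⟩
  | all A ih =>
    obtain rfl | ⟨m, τ, rfl, h⟩ := h
    · exact .inl rfl
    · exact .inr ⟨m, _, rfl, ih h⟩
  | ex A ih =>
    obtain rfl | ⟨A', w, τ, rfl, h⟩ := h
    · exact .inl rfl
    · refine .inr ⟨A', _, _, rfl, fun G m u hu => ?_⟩
      rw [ProofTerm.isubst_rename, ProofTerm.subst_scons_rename, Entry.map_rename_rename,
        ← List.length_append, ← List.append_assoc]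
      exact h (G ++ F) m u (by rwa [List.append_assoc])

theorem reducible_var {E : Env L} {n : ℕ} (hn : ∀ A v, E[n]? ≠ some (some (A, v)))
    (A : Formula L) : Reducible A E (.var n) := by
  intro F ρ _
  refine norm_var_stack (fun A v => ?_) ρ
  change (F ++ E)[n + F.length]? ≠ _
  rw [List.getElem?_append_right (by omega), Nat.add_sub_cancel]
  exact hn A v

/-- The substitution `s` maps the variables in `Γ` to reducible proof terms. -/
def RedSubst (Γ : Ctx L) (E : Env L) (s : ℕ → ProofTerm L) : Prop :=
  ∀ n A, Γ[n]? = some A → Reducible A E (s n)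

theorem RedSubst.mono {Γ : Ctx L} {E : Env L} {s : ℕ → ProofTerm L} (h : RedSubst Γ E s)
    (F : Env L) : RedSubst Γ (F ++ E) (fun n => (s n).rename (· + F.length)) :=
  fun n A hA => (h n A hA).mono F

theorem RedSubst.scons {Γ : Ctx L} {E : Env L} {s : ℕ → ProofTerm L} (h : RedSubst Γ E s)
    {A : Formula L} {u : ProofTerm L} (hu : Reducible A E u) :
    RedSubst (A :: Γ) E (.scons u s) := by
  rintro (_ | n) B hB
  · cases hB
    exact hu
  · exact h n B hB

theorem RedSubst.lift {Γ : Ctx L} {E : Env L} {s : ℕ → ProofTerm L} (h : RedSubst Γ E s) :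
    RedSubst Γ.lift E s := by
  intro n A hA
  simp only [Ctx.lift, List.getElem?_map, Option.map_eq_some_iff] at hA
  obtain ⟨B, hB, rfl⟩ := hA
  rw [Reducible, redStack_isubst]
  exact h n B hB

/-- All instances of `t` by reducible proof terms evaluate on the reducible stacks of type `A`. -/
def Adequate (Γ : Ctx L) (t : ProofTerm L) (A : Formula L) : Prop :=
  ∀ (E : Env L) (θ : ℕ → ITerm L) (s : ℕ → ProofTerm L) (ρ : Stack L),
    RedSubst Γ E s → RedStack A E ρ → Norm E (((t.isubst θ).subst s).stack ρ)

theorem Adequate.reducible {Γ : Ctx L} {t : ProofTerm L} {A : Formula L} (h : Adequate Γ t A)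
    {E : Env L} (θ : ℕ → ITerm L) {s : ℕ → ProofTerm L} (hs : RedSubst Γ E s) :
    Reducible A E ((t.isubst θ).subst s) := by
  intro F ρ hρ
  rw [ProofTerm.rename_subst]
  exact h (F ++ E) θ _ ρ (hs.mono F) hρ

theorem ProofTerm.subst_up_subst_scons (w u : ProofTerm L) (s : ℕ → ProofTerm L) (k : ℕ) :
    (w.subst (up s)).subst (scons u (fun n => var (n + k))) =
      w.subst (scons u (fun n => (s n).rename (· + k))) := by
  rw [subst_subst]
  congr 1
  funext n
  cases n with
  | zero => rfl
  | succ n =>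
    rw [up, shift, subst_rename, scons, rename_eq_subst]
    rfl

theorem Adequate.scons_norm {Γ : Ctx L} {w : ProofTerm L} {A C : Formula L}
    (h : Adequate (A :: Γ) w C) {E : Env L} (θ : ℕ → ITerm L) {s : ℕ → ProofTerm L}
    (hs : RedSubst Γ E s) {ρ : Stack L} (hρ : RedStack C E ρ) (F : Env L) {u : ProofTerm L}
    (hu : Reducible A (F ++ E) u) :
    Norm (F ++ E) ((((w.isubst θ).subst (.up s)).subst
      (.scons u (fun n => .var (n + F.length)))).stack (ρ.map (Entry.rename (· + F.length)))) := by
  rw [ProofTerm.subst_up_subst_scons]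
  exact h _ θ _ _ ((hs.mono F).scons hu) (hρ.mono F)

/-- The condition on a reducible stack of a disjunction or an existential formula, for the trivial
extension of the environment. -/
theorem Norm.subst_inst {E : Env L} {w u : ProofTerm L} {τ : Stack L}
    (h : Norm ([] ++ E) ((w.subst (.scons u (fun n => .var (n + ([] : Env L).length)))).stack
      (τ.map (Entry.rename (· + ([] : Env L).length))))) :
    Norm E ((w.subst (.inst u)).stack τ) := by
  have e₁ : ProofTerm.scons u (fun n => .var (n + ([] : Env L).length)) = .inst u := by
    funext n
    cases n <;> rfl
  have e₂ : τ.map (Entry.rename (· + ([] : Env L).length)) = τ :=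
    (List.map_congr_left fun ξ _ => ξ.rename_id).trans τ.map_id
  rwa [e₁, e₂] at h

theorem reducible_lam_shift {B : Formula L} {E : Env L} {t : ProofTerm L}
    (ht : Reducible B E t) (A D : Formula L) : Reducible (.imp A B) E (.lam D t.shift) := by
  rintro F ρ (rfl | ⟨u, τ, rfl, -, hτ⟩)
  · exact norm_of_isHead trivial nofun
  · refine .of_contract rfl ?_
    convert ht F τ hτ using 2
    change ((t.rename Nat.succ).rename (upRen (· + F.length))).subst (.inst u) = _
    rw [ProofTerm.subst_rename, ProofTerm.subst_rename, ProofTerm.rename_eq_subst]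
    rfl

/-- The heart of the argument. While the left component `u` is evaluated, the bound variable is
the constant that passes its argument to the right component `v`, and it is reducible because `v`
terminates for all reducible values of the variable; while `v` is evaluated, the left component
has no head redexes left, and the variable is as inert as a free one. -/
theorem Adequate.par {Γ : Ctx L} {u v : ProofTerm L} {A B C : Formula L}
    (hu : Adequate (.imp A B :: Γ) u C) (hv : Adequate (.imp B A :: Γ) v C) :
    Adequate Γ (.par A B u v) C := by
  intro E θ s ρ hs hρ
  refine .par_stack ?_
  have hmap : ρ.map Entry.shift = ρ.map (Entry.rename (· + 1)) :=
    List.map_congr_left fun ξ _ => ξ.shift_eq_rename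
  have hup : ProofTerm.up s = .scons (.var 0) (fun n => (s n).rename (· + 1)) := by
    funext n
    cases n <;> rfl
  refine .par ?_ ?_
  · rw [hup, hmap]
    generalize hw : ProofTerm.stack (ProofTerm.subst _ (v.isubst θ)) _ = w
    set e := some (B.isubst θ, w)
    refine hu (e :: E) θ _ _ ((hs.mono [e]).scons ?_) (hρ.mono [e])
    rintro F τ (rfl | ⟨t, τ, rfl, ht, hτ⟩)
    · exact norm_of_isHead trivial nofun
    · refine .comm (n := F.length) (by simp; rfl)
        ⟨τ, by rw [ProofTerm.rename, Nat.zero_add]⟩ ?_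
      have hlen : (F ++ [e]).length = F.length + 1 := by simp
      have hs' := hs.mono (F ++ [e])
      have hρ' := hρ.mono (F ++ [e])
      rw [hlen, List.append_assoc] at hs' hρ'
      have hr := reducible_lam_shift ht B (B.isubst θ)
      convert hv _ θ _ _ (hs'.scons hr) hρ' using 1
      rw [← hw, ProofTerm.subst_stack, ProofTerm.subst_subst, List.map_map]
      congr 1
      · congr 1
        funext n
        cases n with
        | zero => rfl
        | succ n =>
          simp only [ProofTerm.scons, ProofTerm.subst_rename]
          rw [ProofTerm.rename_eq_subst]
          congr 1
          funext i
          change ProofTerm.var _ = _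
          congr 1
          omega
      · refine List.map_congr_left fun ξ _ => ?_
        rw [← Entry.subst_sendSubst ξ F.length (.lam (B.isubst θ) t.shift), Entry.shift_eq_rename]
        rfl
  · rw [hup, hmap]
    exact hv (none :: E) θ _ _ ((hs.mono [none]).scons (reducible_var (by simp) _))
      (hρ.mono [none])

/-- The fundamental lemma of the reducibility relation. -/
theorem adequacy {Γ : Ctx L} {t : ProofTerm L} {A : Formula L} (h : Typed .LC Γ t A) :
    Adequate Γ t A := by
  induction h with
  | var hA =>
    intro E θ s ρ hs hρ
    simpa [ProofTerm.isubst, ProofTerm.subst, ProofTerm.rename_eq_subst, ProofTerm.subst_var]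
      using hs _ _ hA [] ρ hρ
  | pair _ _ ih₁ ih₂ =>
    rintro E θ s ρ hs (rfl | ⟨τ, rfl, hτ⟩ | ⟨τ, rfl, hτ⟩)
    · exact norm_of_isHead trivial nofun
    · exact .of_contract rfl (ih₁ E θ s τ hs hτ)
    · exact .of_contract rfl (ih₂ E θ s τ hs hτ)
  | proj_zero _ ih =>
    intro E θ s ρ hs hρ
    exact ih E θ s (.proj false :: ρ) hs (.inr (.inl ⟨ρ, rfl, hρ⟩))
  | proj_one _ ih =>
    intro E θ s ρ hs hρ
    exact ih E θ s (.proj true :: ρ) hs (.inr (.inr ⟨ρ, rfl, hρ⟩))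
  | app _ _ ih₁ ih₂ =>
    intro E θ s ρ hs hρ
    exact ih₁ E θ s (.arg _ :: ρ) hs (.inr ⟨_, ρ, rfl, ih₂.reducible θ hs, hρ⟩)
  | lam _ ih =>
    rintro E θ s ρ hs (rfl | ⟨u, τ, rfl, hu, hτ⟩)
    · exact norm_of_isHead trivial nofun
    · refine .of_contract rfl ?_
      rw [ProofTerm.subst_up_subst_inst]
      exact ih E θ _ τ (hs.scons hu) hτ
  | inj_zero _ ih =>
    rintro E θ s ρ hs (rfl | ⟨A', w₁, B', w₂, τ, rfl, h, -⟩)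
    · exact norm_of_isHead trivial nofun
    · exact .of_contract rfl (h [] _ (ih.reducible θ hs)).subst_inst
  | inj_one _ ih =>
    rintro E θ s ρ hs (rfl | ⟨A', w₁, B', w₂, τ, rfl, -, h⟩)
    · exact norm_of_isHead trivial nofun
    · exact .of_contract rfl (h [] _ (ih.reducible θ hs)).subst_inst
  | case _ _ _ ih ih₁ ih₂ =>
    intro E θ s ρ hs hρ
    exact ih E θ s (.case _ _ _ _ :: ρ) hs (.inr ⟨_, _, _, _, ρ, rfl,
      fun F u hu => ih₁.scons_norm θ hs hρ F hu, fun F u hu => ih₂.scons_norm θ hs hρ F hu⟩)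
  | iapp m _ ih =>
    intro E θ s ρ hs hρ
    rw [redStack_isubst] at hρ
    exact ih E θ s (.iarg _ :: ρ) hs (.inr ⟨_, ρ, rfl, hρ⟩)
  | ilam _ ih =>
    rintro E θ s ρ hs (rfl | ⟨m, τ, rfl, hτ⟩)
    · exact norm_of_isHead trivial nofun
    · refine .of_contract rfl ?_
      rw [ProofTerm.isubst_subst, ProofTerm.isubst_isubst]
      simp only [ProofTerm.isubst_ishift_iinst]
      exact ih E _ s τ hs.lift hτ
  | ipair m _ ih =>
    rintro E θ s ρ hs (rfl | ⟨A', w, τ, rfl, h⟩)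
    · exact norm_of_isHead trivial nofun
    · refine .of_contract rfl (h [] _ _ ?_).subst_inst
      rw [← redStack_isubst _ (iinst m)]
      exact ih.reducible θ hs
  | icase _ _ ih₁ ih₂ =>
    intro E θ s ρ hs hρ
    refine ih₁ E θ s (.icase _ _ :: ρ) hs (.inr ⟨_, _, ρ, rfl, fun F m u hu => ?_⟩)
    rw [ProofTerm.isubst_subst, ProofTerm.isubst_isubst, ProofTerm.isubst_up]
    simp only [ProofTerm.isubst_ishift_iinst]
    exact ih₂.scons_norm _ hs.lift (by rwa [redStack_isubst]) F hu
  | par _ _ ih₁ ih₂ => exact ih₁.par ih₂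
  | @efq Γ t P hP _ ih =>
    intro E θ s ρ hs hρ
    have : ρ = [] := by
      revert hP hρ
      generalize P = Q
      cases Q <;> simp +contextual [Formula.IsAtomic, RedStack]
    subst this
    exact norm_of_isHead trivial nofun
  | abort A B h => cases h

/-! ### Reduction from the left to the right -/

/-- An elementary process of the form `r σ` with `r` a redex, or `x t σ` with `x` among
the first `k` variables. -/
def Active (k : ℕ) (p : ProofTerm L) : Prop :=
  (∃ p', StackRed p p') ∨ ∃ n < k, ∃ t, Calls n t p

/-- `Idle k p`: no elementary process of `p` is active, the first `k` free variables of `p` being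
bound by parallel operators around `p`. -/
inductive Idle : ℕ → ProofTerm L → Prop
  | par {k : ℕ} {A B : Formula L} {u v : ProofTerm L} :
      Idle (k + 1) u → Idle (k + 1) v → Idle k (.par A B u v)
  | elementary {k : ℕ} {p : ProofTerm L} :
      (∀ A B u v, p ≠ .par A B u v) → ¬Active k p → Idle k p

/-- `ParRed S p p'`: the leftmost active elementary process of `p` is reduced, where `S` lists,
from the innermost one, the parallel operators around `p`: the entry `(A, v)` stands for one that
binds a variable `a` of codomain `A` in `p` and has the other component `v`. -/
inductive ParRed : List (Formula L × ProofTerm L) → ProofTerm L → ProofTerm L → Prop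
  | comm {S : List (Formula L × ProofTerm L)} {n : ℕ} {A : Formula L} {v t p : ProofTerm L} :
      S[n]? = some (A, v) → Calls n t p → ParRed S p (v.subst (sendSubst n (.lam A t.shift)))
  | elim {S : List (Formula L × ProofTerm L)} {p p' : ProofTerm L} :
      StackRed p p' → ParRed S p p'
  | left {S : List (Formula L × ProofTerm L)} {A B : Formula L} {u u' v : ProofTerm L} :
      ParRed ((B, v) :: S) u u' → ParRed S (.par A B u v) (.par A B u' v)
  | right {S : List (Formula L × ProofTerm L)} {A B : Formula L} {u v v' : ProofTerm L} :
      Idle (S.length + 1) u → ParRed ((A, u) :: S) v v' →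
      ParRed S (.par A B u v) (.par A B u v')

theorem Active.ne_par {k : ℕ} {p : ProofTerm L} (h : Active k p) {A B : Formula L}
    {u v : ProofTerm L} : p ≠ .par A B u v := by
  obtain ⟨p', h⟩ | ⟨n, -, t, h⟩ := h
  · exact h.ne_par
  · exact h.ne_par

theorem Idle.not_parRed {k : ℕ} {p : ProofTerm L} (h : Idle k p)
    {S : List (Formula L × ProofTerm L)} (hS : S.length = k) {p' : ProofTerm L} :
    ¬ParRed S p p' := by
  induction h generalizing S p' with
  | par hu hv ihu ihv =>
    subst hS
    intro h
    cases h with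
    | comm _ h => exact h.ne_par rfl
    | elim h => exact h.ne_par rfl
    | left h => exact ihu rfl h
    | right _ h => exact ihv rfl h
  | elementary hp hk =>
    subst hS
    intro h
    cases h with
    | comm h h' => exact hk (.inr ⟨_, (List.getElem?_eq_some_iff.1 h).1, _, h'⟩)
    | elim h => exact hk (.inl ⟨_, h⟩)
    | left h => exact hp _ _ _ _ rfl
    | right _ h => exact hp _ _ _ _ rfl

theorem ProofTerm.contract_of_subst {h r : ProofTerm L} {ξ : Entry L} {s : ℕ → ProofTerm L}
    (hh : ∀ n, h ≠ var n) (e : (h.subst s).contract (ξ.subst s) = some r) :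
    ∃ r', h.contract ξ = some r' := by
  cases h <;> cases ξ <;> first
    | exact (hh _ rfl).elim
    | exact ⟨_, rfl⟩
    | cases e
    | rename Bool => i
      cases i <;> first
        | exact ⟨_, rfl⟩
        | cases e
        | rename Bool => j
          cases j <;> cases e

theorem ProofTerm.IsHead.subst {h : ProofTerm L} (hh : h.IsHead) (hv : ∀ n, h ≠ var n)
    (s : ℕ → ProofTerm L) : (h.subst s).IsHead ∧ ∀ n, h.subst s ≠ var n := by
  cases h <;> simp_all [ProofTerm.subst, IsHead]

theorem ProofTerm.stack_ne_par_of_ne {h : ProofTerm L} (hh : ∀ A B u v, h ≠ par A B u v)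
    (σ : Stack L) (A B : Formula L) (u v : ProofTerm L) : h.stack σ ≠ par A B u v := by
  cases σ with
  | nil => exact hh A B u v
  | cons ξ σ => exact stack_ne_par

/-- An idle proof term remains idle when abstractions or variables replace the variables bound
around it: these can only be the heads of processes that do not apply them to a proof term. -/
theorem Idle.subst {k k' : ℕ} {p : ProofTerm L} (hp : Idle k p) {s : ℕ → ProofTerm L}
    (hs : ∀ i < k, (∃ j, s i = .var j) ∨ ∃ A t, s i = .lam A t)
    (hs' : ∀ i, k ≤ i → ∃ j, k' ≤ j ∧ s i = .var j) : Idle k' (p.subst s) := by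
  induction hp generalizing k' s with
  | @par k A B u v hu hv ihu ihv =>
    have h₁ : ∀ i < k + 1, (∃ j, ProofTerm.up s i = .var j) ∨
        ∃ A t, ProofTerm.up s i = .lam A t := by
      rintro (_ | i) hi
      · exact .inl ⟨0, rfl⟩
      · obtain ⟨j, e⟩ | ⟨A, t, e⟩ := hs i (by omega)
        · exact .inl ⟨j + 1, by rw [ProofTerm.up, e]; rfl⟩
        · exact .inr ⟨A, _, by rw [ProofTerm.up, e]; rfl⟩
    have h₂ : ∀ i, k + 1 ≤ i → ∃ j, k' + 1 ≤ j ∧ ProofTerm.up s i = .var j := by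
      rintro (_ | i) hi
      · omega
      · obtain ⟨j, hj, e⟩ := hs' i (by omega)
        exact ⟨j + 1, by omega, by rw [ProofTerm.up, e]; rfl⟩
    exact .par (ihu h₁ h₂) (ihv h₁ h₂)
  | @elementary k p hp hk =>
    obtain ⟨h, σ, hh, rfl⟩ := p.exists_eq_stack
    rw [ProofTerm.subst_stack]
    have hpar : ∀ A B u v, h ≠ .par A B u v := by
      rintro A B u v rfl
      cases σ with
      | nil => exact hp A B u v rfl
      | cons ξ σ =>
        have e : (ProofTerm.par A B u v).contract ξ =
            some (.par A B (u.elim ξ.shift) (v.elim ξ.shift)) := by cases ξ <;> rfl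
        exact hk (.inl ⟨_, _, ξ, σ, _, rfl, e, rfl⟩)
    by_cases hv : ∃ n, h = .var n
    · obtain ⟨n, rfl⟩ := hv
      have harg (hn : n < k) {u : ProofTerm L} {τ : Stack L} :
          σ.map (Entry.subst s) ≠ .arg u :: τ := by
        intro e
        obtain ⟨ξ, σ, rfl, e, -⟩ := List.map_eq_cons_iff.1 e
        cases ξ <;> cases e
        exact hk (.inr ⟨n, hn, _, σ, rfl⟩)
      have hvar {j : ℕ} (hj : n < k ∨ k' ≤ j) (e : s n = .var j) :
          Idle k' ((s n).stack (σ.map (Entry.subst s))) := by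
        rw [e]
        refine .elementary (ProofTerm.stack_ne_par_of_ne (fun _ _ _ _ e => by cases e) _) ?_
        rintro (⟨p', h⟩ | ⟨m, hm, t, h⟩)
        · obtain ⟨ξ, τ, r, -, e, -⟩ := (stackRed_stack_iff (ProofTerm.isHead_var _)).1 h
          cases e
        · obtain ⟨e, τ, e'⟩ := (calls_stack_iff (ProofTerm.isHead_var _)).1 h
          cases e
          exact harg (by omega) e'
      rcases lt_or_ge n k with hn | hn
      · obtain ⟨j, e⟩ | ⟨A, t, e⟩ := hs n hn
        · exact hvar (.inl hn) e
        · change Idle k' ((s n).stack (σ.map (Entry.subst s)))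
          rw [e]
          refine .elementary (ProofTerm.stack_ne_par_of_ne (fun _ _ _ _ e => by cases e) _) ?_
          rintro (⟨p', h⟩ | ⟨m, hm, u, h⟩)
          · obtain ⟨ξ, τ, r, e, e', -⟩ := (stackRed_stack_iff (h := .lam A t) trivial).1 h
            cases ξ <;> cases e'
            exact harg hn e
          · obtain ⟨e, -⟩ := (calls_stack_iff (h := .lam A t) trivial).1 h
            cases e
      · obtain ⟨j, hj, e⟩ := hs' n hn
        exact hvar (.inr hj) e
    · push Not at hv
      obtain ⟨h₁, h₂⟩ := hh.subst hv s
      refine .elementary (ProofTerm.stack_ne_par_of_ne ?_ _) ?_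
      · cases h with
        | par A B u v => exact (hpar A B u v rfl).elim
        | var n => exact (hv n rfl).elim
        | _ => exact fun _ _ _ _ => nofun
      · rintro (⟨p', h'⟩ | ⟨m, hm, t, h'⟩)
        · obtain ⟨ξ, τ, r, e, e', -⟩ := (stackRed_stack_iff h₁).1 h'
          obtain ⟨ξ, σ, rfl, rfl, -⟩ := List.map_eq_cons_iff.1 e
          obtain ⟨r', e''⟩ := ProofTerm.contract_of_subst hv e'
          exact hk (.inl ⟨_, _, ξ, σ, _, rfl, e'', rfl⟩)
        · exact h₂ m ((calls_stack_iff h₁).1 h').1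

/-- The components of the parallel operators around a process match an environment: the right
components are pending, and the left components are idle. -/
inductive Matches : Env L → List (Formula L × ProofTerm L) → Prop
  | nil : Matches [] []
  | pending {E : Env L} {S : List (Formula L × ProofTerm L)} (e : Formula L × ProofTerm L) :
      Matches E S → Matches (some e :: E) (e :: S)
  | idle {E : Env L} {S : List (Formula L × ProofTerm L)} (A : Formula L) {u : ProofTerm L} :
      Matches E S → Idle (S.length + 1) u → Matches (none :: E) ((A, u) :: S)

theorem Matches.getElem?_of_pending {E : Env L} {S : List (Formula L × ProofTerm L)}
    (h : Matches E S) {n : ℕ} {e : Formula L × ProofTerm L} (he : E[n]? = some (some e)) :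
    S[n]? = some e := by
  induction h generalizing n with
  | nil => cases he
  | pending _ _ ih | idle _ _ _ ih =>
    cases n with
    | zero => simp_all
    | succ n => exact ih he

/-- The entry of index `n` lies outside of `n` binders, so that only `S.length - n` of
the variables bound around the process are free in it. -/
theorem Matches.pending_or_idle {E : Env L} {S : List (Formula L × ProofTerm L)}
    (h : Matches E S) {n : ℕ} {e : Formula L × ProofTerm L} (he : S[n]? = some e) :
    E[n]? = some (some e) ∨ Idle (S.length - n) e.2 := by
  induction h generalizing n with
  | nil => cases he
  | pending e _ ih =>
    cases n with
    | zero => exact .inl (congrArg some he)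
    | succ n => simpa using ih he
  | idle A _ hu ih =>
    cases n with
    | zero =>
      cases he
      exact .inr hu
    | succ n => simpa using ih he

theorem Idle.subst_sendSubst {k n : ℕ} {u : ProofTerm L} (hn : n < k) (hu : Idle (k - n) u)
    (A : Formula L) (t : ProofTerm L) : Idle k (u.subst (sendSubst n (.lam A t))) := by
  refine hu.subst ?_ ?_
  · rintro (_ | i) hi
    · exact .inr ⟨_, _, rfl⟩
    · exact .inl ⟨_, rfl⟩
  · rintro (_ | i) hi
    · omega
    · exact ⟨i + 1 + n, by omega, rfl⟩

theorem Idle.acc {S : List (Formula L × ProofTerm L)} {p : ProofTerm L} (h : Idle S.length p) :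
    Acc (fun p' p => ParRed S p p') p :=
  ⟨_, fun _ hp => (h.not_parRed rfl hp).elim⟩

theorem acc_par_of_idle {S : List (Formula L × ProofTerm L)} {A B : Formula L} {u v : ProofTerm L}
    (hu : Idle (S.length + 1) u) (hv : Acc (fun p' p => ParRed ((A, u) :: S) p p') v) :
    Acc (fun p' p => ParRed S p p') (.par A B u v) := by
  induction hv with
  | intro v _ ih =>
    refine ⟨_, fun p' hp => ?_⟩
    cases hp with
    | comm _ h => exact (h.ne_par rfl).elim
    | elim h => exact (h.ne_par rfl).elim
    | left h => exact (hu.not_parRed rfl h).elim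
    | right _ h => exact ih _ h

theorem acc_par {S : List (Formula L × ProofTerm L)} {A B : Formula L} {u v : ProofTerm L}
    (hu : Acc (fun p' p => ParRed ((B, v) :: S) p p') u)
    (hv : ∀ u, Idle (S.length + 1) u → Acc (fun p' p => ParRed ((A, u) :: S) p p') v) :
    Acc (fun p' p => ParRed S p p') (.par A B u v) := by
  induction hu with
  | intro u _ ih =>
    refine ⟨_, fun p' hp => ?_⟩
    cases hp with
    | comm _ h => exact (h.ne_par rfl).elim
    | elim h => exact (h.ne_par rfl).elim
    | left h => exact ih _ h
    | right hu h => exact (acc_par_of_idle hu (hv u hu)).inv (.right hu h)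

/-- Evaluation simulates the reduction from the left to the right. It takes a variable whose
binder has an idle left component as inert; calling it puts a copy of that component in place,
which is idle again. -/
theorem Norm.acc {E : Env L} {p : ProofTerm L} (h : Norm E p)
    {S : List (Formula L × ProofTerm L)} (hS : Matches E S) :
    Acc (fun p' p => ParRed S p p') p := by
  induction h generalizing S with
  | par _ _ ihu ihv => exact acc_par (ihu (hS.pending _)) fun u hu => ihv (hS.idle _ hu)
  | comm hn hc _ ih =>
    refine ⟨_, fun p' hp => ?_⟩
    cases hp with
    | comm hn' hc' =>
      obtain ⟨rfl, rfl⟩ := hc.unique hc'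
      rw [hS.getElem?_of_pending hn] at hn'
      cases hn'
      exact ih hS
    | elim h => exact (hc.not_stackRed h).elim
    | left h => exact (hc.ne_par rfl).elim
    | right _ h => exact (hc.ne_par rfl).elim
  | elim hr _ ih =>
    refine ⟨_, fun p' hp => ?_⟩
    cases hp with
    | comm _ hc => exact (hc.not_stackRed hr).elim
    | elim h =>
      cases hr.unique h
      exact ih hS
    | left h => exact (hr.ne_par rfl).elim
    | right _ h => exact (hr.ne_par rfl).elim
  | halt hp hr hc =>
    refine ⟨_, fun p' h => ?_⟩
    cases h with
    | comm hn hc' =>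
      obtain h | h := hS.pending_or_idle hn
      · exact (hc _ _ _ _ h hc').elim
      · exact (h.subst_sendSubst (List.getElem?_eq_some_iff.1 hn).1 _ _).acc
    | elim h => exact (hr _ h).elim
    | left h => exact (hp _ _ _ _ rfl).elim
    | right _ h => exact (hp _ _ _ _ rfl).elim

/-! ### Proof terms without abort constants -/

/-- No abort constant occurs in the proof term. -/
def AbortFree : ProofTerm L → Prop
  | .var _ => True
  | .abort _ _ => False
  | .pair t u => AbortFree t ∧ AbortFree u
  | .proj t _ => AbortFree t
  | .lam _ t => AbortFree t
  | .app t u => AbortFree t ∧ AbortFree u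
  | .inj _ t => AbortFree t
  | .case t _ w₁ _ w₂ => AbortFree t ∧ AbortFree w₁ ∧ AbortFree w₂
  | .ilam t => AbortFree t
  | .iapp t _ => AbortFree t
  | .ipair _ t => AbortFree t
  | .icase t _ w => AbortFree t ∧ AbortFree w
  | .par _ _ u v => AbortFree u ∧ AbortFree v
  | .efq _ t => AbortFree t

theorem Typed.abortFree {Γ : Ctx L} {t : ProofTerm L} {A : Formula L} (h : Typed .LC Γ t A) :
    AbortFree t := by
  induction h <;> simp_all [AbortFree]

theorem abortFree_isubst {t : ProofTerm L} {s : ℕ → ITerm L} :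
    AbortFree (t.isubst s) ↔ AbortFree t := by
  induction t generalizing s <;> simp_all [AbortFree, ProofTerm.isubst]

theorem abortFree_rename {t : ProofTerm L} {f : ℕ → ℕ} :
    AbortFree (t.rename f) ↔ AbortFree t := by
  induction t generalizing f <;> simp_all [AbortFree, ProofTerm.rename]

theorem abortFree_up {s : ℕ → ProofTerm L} (hs : ∀ n, AbortFree (s n)) (n : ℕ) :
    AbortFree (ProofTerm.up s n) := by
  cases n with
  | zero => trivial
  | succ n => exact abortFree_rename.2 (hs n)

theorem AbortFree.subst {t : ProofTerm L} (ht : AbortFree t) {s : ℕ → ProofTerm L}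
    (hs : ∀ n, AbortFree (s n)) : AbortFree (t.subst s) := by
  induction t generalizing s <;>
    simp_all [AbortFree, ProofTerm.subst, abortFree_up, abortFree_isubst]

theorem abortFree_inst {t : ProofTerm L} (ht : AbortFree t) (n : ℕ) :
    AbortFree (ProofTerm.inst t n) := by
  cases n with
  | zero => exact ht
  | succ n => trivial

theorem AbortFree.of_elim {t : ProofTerm L} {ξ : Entry L} (h : AbortFree (t.elim ξ)) :
    AbortFree t := by
  cases ξ <;> simp_all [ProofTerm.elim, AbortFree]

theorem AbortFree.elim_of {t t' : ProofTerm L} {ξ : Entry L} (h : AbortFree (t.elim ξ))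
    (ht' : AbortFree t') : AbortFree (t'.elim ξ) := by
  cases ξ <;> simp_all [ProofTerm.elim, AbortFree]

theorem AbortFree.of_stack {t : ProofTerm L} {σ : Stack L} (h : AbortFree (t.stack σ)) :
    AbortFree t := by
  induction σ generalizing t with
  | nil => exact h
  | cons ξ σ ih => exact (ih h).of_elim

theorem AbortFree.stack_of {t t' : ProofTerm L} {σ : Stack L} (h : AbortFree (t.stack σ))
    (ht' : AbortFree t') : AbortFree (t'.stack σ) := by
  induction σ generalizing t t' with
  | nil => exact ht'
  | cons ξ σ ih => exact ih h (AbortFree.elim_of (AbortFree.of_stack h) ht')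

theorem AbortFree.contract {t r : ProofTerm L} {ξ : Entry L} (h : AbortFree (t.elim ξ))
    (e : t.contract ξ = some r) : AbortFree r := by
  unfold ProofTerm.contract at e
  split at e <;> cases e
  case h_8 A B u v =>
    have := h.of_elim
    cases ξ <;>
      simp_all [AbortFree, ProofTerm.elim, Entry.shift, ProofTerm.shift, abortFree_rename]
  all_goals simp_all [AbortFree, ProofTerm.elim, AbortFree.subst, abortFree_isubst, abortFree_inst]

theorem AbortFree.parRed {S : List (Formula L × ProofTerm L)} {p p' : ProofTerm L}
    (h : ParRed S p p') (hp : AbortFree p) (hS : ∀ e ∈ S, AbortFree e.2) : AbortFree p' := by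
  induction h with
  | comm hn hc =>
    obtain ⟨σ, rfl⟩ := hc
    have ht : AbortFree _ := (AbortFree.of_stack (σ := σ) hp).2
    refine (hS _ (List.mem_of_getElem? hn)).subst fun i => ?_
    cases i with
    | zero => exact abortFree_rename.2 ht
    | succ i => trivial
  | elim hr =>
    obtain ⟨h, ξ, σ, r, rfl, e, rfl⟩ := hr
    exact AbortFree.stack_of hp (AbortFree.contract (AbortFree.of_stack (σ := σ) hp) e)
  | left _ ih => exact ⟨ih hp.1 (List.forall_mem_cons.2 ⟨hp.2, hS⟩), hp.2⟩
  | right _ _ ih => exact ⟨hp.1, ih hp.2 (List.forall_mem_cons.2 ⟨hp.1, hS⟩)⟩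

/-! ### Head reduction -/

namespace ParCtx

/-- The composition of parallel contexts. -/
def comp : ParCtx L → ParCtx L → ParCtx L
  | hole, D => D
  | left A B C v, D => left A B (C.comp D) v
  | right A B u C, D => right A B u (C.comp D)

theorem fill_comp (C D : ParCtx L) (p : ProofTerm L) :
    (C.comp D).fill p = C.fill (D.fill p) := by
  induction C <;> simp_all [comp, fill]

theorem numLeft_comp (C D : ParCtx L) : (C.comp D).numLeft = C.numLeft + D.numLeft := by
  induction C <;> simp_all [comp, numLeft, Nat.add_assoc]

/-- The other components of the parallel operators around the hole, with the codomains of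
the variables that these bind there, on top of those around the context. -/
def siblings : ParCtx L → List (Formula L × ProofTerm L) → List (Formula L × ProofTerm L)
  | hole, S => S
  | left _ B C v, S => C.siblings ((B, v) :: S)
  | right A _ u C, S => C.siblings ((A, u) :: S)

theorem siblings_comp (C D : ParCtx L) (S : List (Formula L × ProofTerm L)) :
    (C.comp D).siblings S = D.siblings (C.siblings S) := by
  induction C generalizing S <;> simp_all [comp, siblings]

theorem getElem?_siblings (C : ParCtx L) (S : List (Formula L × ProofTerm L)) (n : ℕ) :
    (C.siblings S)[C.depth + n]? = S[n]? := by
  induction C generalizing S n with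
  | hole => simp [siblings, depth]
  | left A B C v ih | right A B v C ih =>
    rw [siblings, depth, Nat.add_assoc, ih, Nat.add_comm]
    rfl

/-- A binder of a parallel context splits it into the parts outside and inside of the binder. -/
theorem exists_split (D : ParCtx L) {n : ℕ} (hn : n < D.depth) :
    ∃ (D' : ParCtx L) (A B : Formula L) (C : ParCtx L) (v : ProofTerm L), C.depth = n ∧
      (D = D'.comp (left A B C v) ∨ D = D'.comp (right A B v C)) := by
  induction D with
  | hole => cases hn
  | left A B C v ih =>
    obtain h | h := Nat.lt_succ_iff_lt_or_eq.1 hn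
    · obtain ⟨D', A', B', C', v', hC, h⟩ := ih h
      exact ⟨left A B D' v, A', B', C', v', hC, by rcases h with rfl | rfl <;> simp [comp]⟩
    · exact ⟨hole, A, B, C, v, h.symm, .inl rfl⟩
  | right A B u C ih =>
    obtain h | h := Nat.lt_succ_iff_lt_or_eq.1 hn
    · obtain ⟨D', A', B', C', v', hC, h⟩ := ih h
      exact ⟨right A B u D', A', B', C', v', hC, by rcases h with rfl | rfl <;> simp [comp]⟩
    · exact ⟨hole, A, B, C, u, h.symm, .inr rfl⟩

end ParCtx

theorem AbortFree.of_fill {C : ParCtx L} {p : ProofTerm L} (h : AbortFree (C.fill p)) :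
    AbortFree p := by
  induction C with
  | hole => exact h
  | left A B C v ih => exact ih h.1
  | right A B u C ih => exact ih h.2

/-- A head redex starts in every active elementary process. -/
theorem Active.exists_headContract {D : ParCtx L} {q : ProofTerm L} (h : Active D.depth q)
    (Γ : Ctx L) : ∃ (C : ParCtx L) (n : ℕ) (p p' : ProofTerm L),
      D.fill q = C.fill p ∧ HeadContract (C.ctx Γ) n p p' ∧ C.numLeft + n = D.numLeft := by
  obtain ⟨_, h, ξ, σ, r, rfl, e, rfl⟩ | ⟨n, hn, t, σ, rfl⟩ := h
  · exact ⟨D, 0, _, _, rfl, .elim σ (ProofTerm.elimRed_of_contract e), rfl⟩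
  · obtain ⟨D', A, B, C, v, rfl, rfl | rfl⟩ := D.exists_split hn
    · exact ⟨D', _, _, _, ParCtx.fill_comp _ _ _, .comm_left A B C t v σ,
        (D'.numLeft_comp (.left A B C v)).symm⟩
    · exact ⟨D', _, _, _, ParCtx.fill_comp _ _ _, .comm_right A B C t v σ,
        (D'.numLeft_comp (.right A B v C)).symm⟩

/-- Contracting a head redex reduces the active elementary process in which it starts. -/
theorem HeadContract.exists_parRed {Γ : Ctx L} {n : ℕ} {p p' : ProofTerm L}
    (h : HeadContract Γ n p p') (hp : AbortFree p) :
    ∃ (D : ParCtx L) (q q' : ProofTerm L), p = D.fill q ∧ p' = D.fill q' ∧ D.numLeft = n ∧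
      Active D.depth q ∧ ∀ S, ParRed (D.siblings S) q q' := by
  cases h with
  | comm_left A B C t v σ =>
    refine ⟨.left A B C v, _, _, rfl, rfl, rfl, .inr ⟨_, Nat.lt_succ_self _, t, σ, rfl⟩,
      fun S => .comm ?_ ⟨σ, rfl⟩⟩
    exact C.getElem?_siblings _ 0
  | comm_right A B C t u σ =>
    refine ⟨.right A B u C, _, _, rfl, rfl, rfl, .inr ⟨_, Nat.lt_succ_self _, t, σ, rfl⟩,
      fun S => .comm ?_ ⟨σ, rfl⟩⟩
    exact C.getElem?_siblings _ 0
  | elim σ h =>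
    exact ⟨.hole, _, _, rfl, rfl, rfl, .inl ⟨_, h.stackRed σ⟩, fun S => .elim (h.stackRed σ)⟩
  | @abort A B D t σ _ _ => exact (AbortFree.of_stack (σ := σ) hp).1.elim

theorem exists_active_of_not_idle {k : ℕ} {u : ProofTerm L} (h : ¬Idle k u) :
    ∃ (D : ParCtx L) (q : ProofTerm L), u = D.fill q ∧ Active (k + D.depth) q ∧
      D.numLeft < u.numProc := by
  have key (k : ℕ) (p : ProofTerm L) (hp : ∀ A B u v, p ≠ .par A B u v) (h : ¬Idle k p) :
      ∃ (D : ParCtx L) (q : ProofTerm L), p = D.fill q ∧ Active (k + D.depth) q ∧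
        D.numLeft < p.numProc := by
    refine ⟨.hole, p, rfl, by_contra fun ha => h (.elementary hp ha), ?_⟩
    cases p with
    | par A B u v => exact (hp A B u v rfl).elim
    | _ => exact Nat.one_pos
  induction u generalizing k with
  | par A B u v ihu ihv =>
    by_cases hu : Idle (k + 1) u
    · by_cases hv : Idle (k + 1) v
      · exact (h (.par hu hv)).elim
      · obtain ⟨D, q, rfl, ha, hlt⟩ := ihv hv
        refine ⟨.right A B u D, q, rfl, ?_, Nat.add_lt_add_left hlt _⟩
        rwa [ParCtx.depth, Nat.add_comm D.depth, ← Nat.add_assoc]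
    · obtain ⟨D, q, rfl, ha, hlt⟩ := ihu hu
      refine ⟨.left A B D v, q, rfl, ?_, Nat.lt_add_right _ hlt⟩
      rwa [ParCtx.depth, Nat.add_comm D.depth, ← Nat.add_assoc]
  | _ => exact key _ _ (fun _ _ _ _ => nofun) h

/-- Reducing an elementary process is a reduction from the left to the right if no active
elementary process is to the left of it. -/
theorem parRed_fill {D : ParCtx L} {q q' : ProofTerm L} {S : List (Formula L × ProofTerm L)}
    (h : ParRed (D.siblings S) q q')
    (hmin : ∀ (C : ParCtx L) (p : ProofTerm L), D.fill q = C.fill p →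
      Active (S.length + C.depth) p → D.numLeft ≤ C.numLeft) :
    ParRed S (D.fill q) (D.fill q') := by
  induction D generalizing S with
  | hole => exact h
  | left A B D v ih =>
    refine .left (ih h fun C p e ha => hmin (.left A B C v) p ?_ ?_)
    · rw [ParCtx.fill, ParCtx.fill, e]
    · rwa [ParCtx.depth, Nat.add_comm C.depth, ← Nat.add_assoc]
  | right A B u D ih =>
    refine .right (by_contra fun hu => ?_) (ih h fun C p e ha => ?_)
    · obtain ⟨C, p, e, ha, hlt⟩ := exists_active_of_not_idle hu
      have := hmin (.left A B C (D.fill q)) p (by rw [ParCtx.fill, ParCtx.fill, e])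
        (by rwa [ParCtx.depth, Nat.add_comm C.depth, ← Nat.add_assoc])
      simp only [ParCtx.numLeft] at this
      omega
    · have := hmin (.right A B u C) p (by rw [ParCtx.fill, ParCtx.fill, e])
        (by rwa [ParCtx.depth, Nat.add_comm C.depth, ← Nat.add_assoc])
      simp only [ParCtx.numLeft] at this
      omega

theorem HeadRed.parRed {Γ : Ctx L} {t t' : ProofTerm L} (h : HeadRed Γ t t')
    (ht : AbortFree t) : ParRed [] t t' := by
  obtain ⟨C, n, p, p', rfl, rfl, hc, hmin⟩ := h
  obtain ⟨D, q, q', rfl, rfl, rfl, -, hq⟩ := hc.exists_parRed ht.of_fill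
  rw [← ParCtx.fill_comp, ← ParCtx.fill_comp]
  refine parRed_fill (by rw [ParCtx.siblings_comp]; exact hq _) fun C' p e ha => ?_
  rw [List.length_nil, Nat.zero_add] at ha
  obtain ⟨C'', m, r, r', e', hc', hm⟩ := ha.exists_headContract Γ
  rw [ParCtx.numLeft_comp, ← hm]
  exact hmin C'' m r r' (by rw [← ParCtx.fill_comp, e, e']) hc'

theorem Norm.not_exists_headRed {Γ : Ctx L} {t : ProofTerm L} (h : Norm [] t)
    (ht : AbortFree t) :
    ¬∃ f : ℕ → ProofTerm L, f 0 = t ∧ ∀ n, HeadRed Γ (f n) (f (n + 1)) := by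
  have hacc := h.acc .nil
  clear h
  induction hacc with
  | intro t _ ih =>
    rintro ⟨f, rfl, hf⟩
    have hr := (hf 0).parRed ht
    exact ih _ hr (ht.parRed hr (by simp)) ⟨fun n => f (n + 1), rfl, fun n => hf (n + 1)⟩

theorem Typed.lcStar {S : System} {Γ : Ctx L} {t : ProofTerm L} {A : Formula L}
    (h : Typed S Γ t A) : Typed .LCstar Γ t A := by
  induction h with
  | abort A B _ => exact .abort A B rfl
  | efq hP _ ih => exact .efq hP ih
  | _ => constructor <;> assumption

theorem Typed.norm {Γ : Ctx L} {t : ProofTerm L} {A : Formula L} (h : Typed .LC Γ t A) :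
    Norm [] t := by
  have := adequacy h [] .var .var [] (fun n B _ => reducible_var (by simp) B) (redStack_nil A [])
  rwa [ProofTerm.isubst_var, ProofTerm.subst_var] at this

end

end DummettLC

theorem mainTheorem2 (L : FirstOrder.Language.{u, v}) (Γ : DummettLC.Ctx L)
    (t : DummettLC.ProofTerm L) (A : DummettLC.Formula L)
    (ht : DummettLC.Typed DummettLC.System.LC Γ t A) :
    t ∈ DummettLC.HNstar Γ :=
  ⟨⟨A, ht.lcStar⟩, ht.norm.not_exists_headRed ht.abortFree⟩
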